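/- Let $\Gamma=\{O\}\cup\bigcup_{i}(0,\infty)e_i\subset\mathbb R^2$, where $O=(0,0)$ and $e_i\in\{(1,0),(0,1),(-1,0),(0,-1)\}$, and let $d(x)=x_1^2x_2^2$. Let $A=\overline B(0,1)\subset\mathbb R^2$ be the closed Euclidean unit ball, let $\mathcal A=L^\infty((0,\infty);A)$ be the set of controls, and let $\lambda>0$. Let $\ell:\mathbb R^2\to\mathbb R$ (a running cost that does not depend on the control) be bounded and satisfy $|\ell(x)-\ell(y)|\le m_\ell(|x-y|)$ for some modulus of continuity $m_\ell$. For $x\in\mathbb R^2$, $\alpha\in\mathcal A$ and $\varepsilon>0$, let $X^{x,\alpha,\varepsilon}$ be the solution of $\dot X(t)=\alpha(t)-\frac1\varepsilon\nabla d(X(t))$, $X(0)=x$, on $[0,\infty)$, and let $k^{x,\alpha,\varepsilon}(t)=\frac1\varepsilon\int_0^t\nabla d(X^{x,\alpha,\varepsilon}(s))\,ds$. Let $\omega(x,\alpha)$ be the set of all $X\in H^1_{\rm loc}(0,\infty)$ for which there are $k$ and $\varepsilon_n\to0^+$ such that $(X^{x,\alpha,\varepsilon_n},k^{x,\alpha,\varepsilon_n})\to(X,k)$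 locally uniformly on $(0,\infty)$. Define $$V^\varepsilon(x)=\inf_{\alpha\in\mathcal A}\int_0^\infty e^{-\lambda t}\ell(X^{x,\alpha,\varepsilon}(t))\,dt,\qquad \overline V(x)=\inf_{\alpha\in\mathcal A,\;X\in\omega(x,\alpha)}\int_0^\infty e^{-\lambda t}\ell(X(t))\,dt,$$ and, for $x\in\Gamma$, $$V_\Gamma(x)=\inf\Big\{\int_0^\infty e^{-\lambda t}\ell(X(t))\,dt:\ \alpha\in\mathcal A,\ X(t)=x+\int_0^t\alpha(s)\,ds\in\Gamma\ \text{ for all } t\ge0\Big\}.$$ Then: (1) $\overline V=V_\Gamma$ on $\Gamma$. (2) For every $x\in\mathbb R^2$ the solution $Z^x$ of $\dot Z=-\nabla d(Z)$, $Z(0)=x$, has a limit $\phi_d(x):=\lim_{t\to\infty}Z^x(t)$, this limit belongs to $\Gamma$, and $V^\varepsilon$ converges to $\overline V\circ\phi_d$ locally uniformly on $\mathbb R^2$ as $\varepsilon\to0^+$. -/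

import Mathlib

open Set Filter Topology MeasureTheory

noncomputable section

namespace NetworkControl

/-- The Euclidean plane. -/
abbrev Plane : Type := EuclideanSpace ℝ (Fin 2)

/-- The four unit vectors pointing East, North, West and South. -/
def cardinal : Fin 4 → Plane := ![!₂[1, 0], !₂[0, 1], !₂[-1, 0], !₂[0, -1]]

/-- The junction `Γ`: the origin together with the four open branches `(0,∞) e_i`. -/
def network : Set Plane := {0} ∪ ⋃ i : Fin 4, (fun r : ℝ => r • cardinal i) '' Ioi 0

/-- The function `d(x) = x₁² x₂²`. -/
def d (x : Plane) : ℝ := x 0 ^ 2 * x 1 ^ 2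

/-- A modulus of continuity (no monotonicity or subadditivity is required); only its values on
`[0,∞)` matter. -/
def IsModulus (m : ℝ → ℝ) : Prop :=
  (∀ r, 0 ≤ r → 0 ≤ m r) ∧ Tendsto m (𝓝[≥] 0) (𝓝 0)

/-- The standing assumptions on the dynamics `f` and the running cost `ℓ`: joint continuity,
a common bound `M`, Lipschitz continuity of `f` and uniform continuity of `ℓ` in the state,
uniformly with respect to the control value. -/
def StandingAssumptions {A : Type*} [TopologicalSpace A]
    (f : Plane → A → Plane) (ℓ : Plane → A → ℝ) : Prop :=
  Continuous (Function.uncurry f) ∧ Continuous (Function.uncurry ℓ) ∧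
    ∃ M : ℝ, 0 < M ∧ ∃ m : ℝ → ℝ, IsModulus m ∧
      ∀ (a : A) (x y : Plane),
        ‖f x a‖ ≤ M ∧ ‖f x a - f y a‖ ≤ M * ‖x - y‖ ∧
        |ℓ x a| ≤ M ∧ |ℓ x a - ℓ y a| ≤ m ‖x - y‖

section Trajectories

variable {A : Type*}

/-- `X` solves `Ẋ = f(X, α)` on `[0,∞)` with `X(0) = x`, in the Carathéodory sense (the values
of `X` and of `α` at negative times play no role). -/
def IsTrajectory (f : Plane → A → Plane) (x : Plane) (α : ℝ → A) (X : ℝ → Plane) : Prop :=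
  ContinuousOn X (Ici 0) ∧ ∀ t, 0 ≤ t → X t = x + ∫ s in (0 : ℝ)..t, f (X s) (α s)

/-- The perturbed dynamics `F^ε(x, a) = f(x, a) - ε⁻¹ ∇d(x)`. -/
def perturbed (f : Plane → A → Plane) (ε : ℝ) (x : Plane) (a : A) : Plane :=
  f x a - ε⁻¹ • gradient d x

/-- The penalization term `k^ε(t) = ε⁻¹ ∫₀ᵗ ∇d(X(s)) ds` along a trajectory `X`. -/
def penalization (ε : ℝ) (X : ℝ → Plane) (t : ℝ) : Plane :=
  ε⁻¹ • ∫ s in (0 : ℝ)..t, gradient d (X s)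

/-- `X ∈ H¹_loc(0,∞)`, for the continuous representative: `X` is a primitive on `(0,∞)` of
a function which is square integrable on every compact subinterval of `(0,∞)`. -/
def MemH1Loc (X : ℝ → Plane) : Prop :=
  ∃ g : ℝ → Plane, ∀ a b : ℝ, 0 < a → a ≤ b →
    MemLp g 2 (volume.restrict (Icc a b)) ∧ X b - X a = ∫ s in a..b, g s

/-- The set `ω(x, α)` of the subsequential limits `X`, for the locally uniform convergence on
`(0,∞)` of the pairs `(X^ε, k^ε)` as `ε → 0⁺`. -/
def omegaLimits (f : Plane → A → Plane) (x : Plane) (α : ℝ → A) : Set (ℝ → Plane) :=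
  {X | MemH1Loc X ∧ ∃ (k : ℝ → Plane) (ε : ℕ → ℝ) (Y : ℕ → ℝ → Plane),
    (∀ n, 0 < ε n) ∧ Tendsto ε atTop (𝓝 0) ∧
    (∀ n, IsTrajectory (perturbed f (ε n)) x α (Y n)) ∧
    TendstoLocallyUniformlyOn Y X atTop (Ioi 0) ∧
    TendstoLocallyUniformlyOn (fun n => penalization (ε n) (Y n)) k atTop (Ioi 0)}

/-- The discounted cost `∫₀^∞ e^{-λt} ℓ(X(t), α(t)) dt`. -/
def cost (lam : ℝ) (ℓ : Plane → A → ℝ) (α : ℝ → A) (X : ℝ → Plane) : ℝ :=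
  ∫ t in Ioi (0 : ℝ), Real.exp (-lam * t) * ℓ (X t) (α t)

end Trajectories

section ValueFunctions

variable {A : Type*} [MeasurableSpace A]

/-- The value function `V_Γ`: infimum over the measurable controls whose (unperturbed)
trajectory from `x` stays on the network. -/
def valueNetwork (lam : ℝ) (f : Plane → A → Plane) (ℓ : Plane → A → ℝ) (x : Plane) : ℝ :=
  sInf {c | ∃ (α : ℝ → A) (X : ℝ → Plane), Measurable α ∧ IsTrajectory f x α X ∧
    (∀ t, 0 ≤ t → X t ∈ network) ∧ c = cost lam ℓ α X}

/-- The value function `V^ε` of the perturbed control problem. -/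
def valuePerturbed (lam : ℝ) (f : Plane → A → Plane) (ℓ : Plane → A → ℝ)
    (ε : ℝ) (x : Plane) : ℝ :=
  sInf {c | ∃ (α : ℝ → A) (X : ℝ → Plane), Measurable α ∧
    IsTrajectory (perturbed f ε) x α X ∧ c = cost lam ℓ α X}

/-- The limit value function: infimum over all measurable controls `α` and all `X ∈ ω(x, α)`. -/
def valueLimit (lam : ℝ) (f : Plane → A → Plane) (ℓ : Plane → A → ℝ) (x : Plane) : ℝ :=
  sInf {c | ∃ (α : ℝ → A) (X : ℝ → Plane), Measurable α ∧
    X ∈ omegaLimits f x α ∧ c = cost lam ℓ α X}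

end ValueFunctions

/-- `Z` is the solution on `[0,∞)` of the gradient flow `Ż = -∇d(Z)`, `Z(0) = x`. -/
def IsGradientFlow (x : Plane) (Z : ℝ → Plane) : Prop :=
  Z 0 = x ∧ ∀ t, 0 ≤ t → HasDerivWithinAt Z (-gradient d (Z t)) (Ici 0) t

/-- `y` is the limit, as `t → ∞`, of the gradient flow of `d` starting from `x`. -/
def IsFlowLimit (x y : Plane) : Prop :=
  ∃ Z : ℝ → Plane, IsGradientFlow x Z ∧ Tendsto Z atTop (𝓝 y)

/-- The map `φ_d : x ↦ lim_{t → ∞} Z^x(t)`. -/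
def flowProj (x : Plane) : Plane := Classical.epsilon (IsFlowLimit x)

/-- The set of control values in the Eikonal setting: the closed unit ball. -/
abbrev UnitBall : Type := Metric.closedBall (0 : Plane) 1

/-- The Eikonal dynamics `f(x, a) = a`. -/
def eikonal (_x : Plane) (a : UnitBall) : Plane := (a : Plane)

end NetworkControl

end

noncomputable section

namespace NetworkControl

/-! ### Geometry of the plane relative to the network -/

/-! Everything rests on two functions: `saddle`, q = x₁² − x₂², and `coordProd`, p = x₁x₂, with d =
p² and Γ = {p = 0}. Since ∇q ⟂ ∇d, the penalization does not act on q, so along any perturbed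
trajectory q varies at rate at most 2‖X‖, independently of ε (`abs_saddle_sub_le`). Meanwhile d is
driven to 0 at every positive time (`eventually_d_le`). As ‖x‖⁴ = q² + 4p², a point is determined by
q and its quadrant up to an error of order √|p| (`norm_sub_sq_le`). Hence perturbed trajectories are
Hölder-1/2 in time up to a vanishing error, and subsequences converge at every positive time
(`exists_subseq_tendsto`).

On an axis q = ±xᵢ², so the ε-free bound on q becomes |ẋᵢ| ≤ 1 in the limit. Limits are therefore
1-Lipschitz curves in Γ, that is, admissible curves of the network problem; after an instantaneous
initial layer they start at the projection of x (`exists_isTrajectory_of_tendsto`). The cost ignores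
the control, so it passes to the limit. This gives V_Γ ≤ V̄ on Γ and the lower bound for V^ε.

Conversely ∇d = 0 on Γ, so a network trajectory solves the perturbed equation for every ε. From a
point off Γ, the zero control lets the gradient flow act until the drift ε⁻¹∇d is at most 1/2; the
remaining control then beats it and reaches Γ (`exists_reachable_network`). Moving along an axis
next, a given network trajectory can be followed with a delay tending to 0, which gives the upper
bound.

The gradient flow itself is solved explicitly; its limit is identified by being an equilibrium with
the same q in the same closed quadrant where this matters. -/

/-- The quadratic form `x₁² - x₂²`, which is conserved by the gradient flow of `d`. -/
def saddle (x : Plane) : ℝ := x 0 ^ 2 - x 1 ^ 2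

/-- The product of the coordinates, whose square is `d`. -/
def coordProd (x : Plane) : ℝ := x 0 * x 1

lemma norm_sq_eq (x : Plane) : ‖x‖ ^ 2 = x 0 ^ 2 + x 1 ^ 2 := by
  simp [EuclideanSpace.norm_sq_eq, Fin.sum_univ_two]

lemma inner_eq (x y : Plane) : inner ℝ x y = x 0 * y 0 + x 1 * y 1 := by
  simp [PiLp.inner_apply, Fin.sum_univ_two, mul_comm]

lemma hasFDerivAt_coord (i : Fin 2) (x : Plane) :
    HasFDerivAt (fun y : Plane => y i) (EuclideanSpace.proj i : Plane →L[ℝ] ℝ) x :=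
  (EuclideanSpace.proj i : Plane →L[ℝ] ℝ).hasFDerivAt

lemma hasGradientAt_of_hasFDerivAt {F : Plane → ℝ} {F' : Plane →L[ℝ] ℝ} {x g : Plane}
    (h : HasFDerivAt F F' x) (hg : ∀ v : Plane, F' v = g 0 * v 0 + g 1 * v 1) :
    HasGradientAt F g x := by
  rw [hasGradientAt_iff_hasFDerivAt]
  have : (InnerProductSpace.toDual ℝ Plane) g = F' := by
    refine ContinuousLinearMap.ext fun v => ?_
    rw [InnerProductSpace.toDual_apply_apply, inner_eq, hg]
  rwa [this]

lemma hasGradientAt_d (x : Plane) :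
    HasGradientAt d !₂[2 * x 0 * x 1 ^ 2, 2 * x 0 ^ 2 * x 1] x := by
  refine hasGradientAt_of_hasFDerivAt
    (((hasFDerivAt_coord 0 x).pow 2).mul ((hasFDerivAt_coord 1 x).pow 2)) fun v => ?_
  simp
  ring

lemma gradient_d (x : Plane) : gradient d x = !₂[2 * x 0 * x 1 ^ 2, 2 * x 0 ^ 2 * x 1] :=
  (hasGradientAt_d x).gradient

lemma gradient_d_zero (x : Plane) : gradient d x 0 = 2 * x 0 * x 1 ^ 2 := by
  simp [gradient_d]

lemma gradient_d_one (x : Plane) : gradient d x 1 = 2 * x 0 ^ 2 * x 1 := by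
  simp [gradient_d]

lemma gradient_d_eq_zero {x : Plane} (h : coordProd x = 0) : gradient d x = 0 := by
  unfold coordProd at h
  ext i
  fin_cases i
  · simp only [Fin.zero_eta, gradient_d_zero, PiLp.zero_apply]
    linear_combination 2 * x 1 * h
  · simp only [Fin.mk_one, gradient_d_one, PiLp.zero_apply]
    linear_combination 2 * x 0 * h

lemma continuous_gradient_d : Continuous (gradient d) := by
  have : gradient d = fun x : Plane => !₂[2 * x 0 * x 1 ^ 2, 2 * x 0 ^ 2 * x 1] :=
    funext gradient_d
  rw [this]
  fun_prop

lemma d_eq (x : Plane) : d x = coordProd x ^ 2 := by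
  simp only [d, coordProd]; ring

lemma hasGradientAt_saddle (x : Plane) : HasGradientAt saddle !₂[2 * x 0, -(2 * x 1)] x := by
  refine hasGradientAt_of_hasFDerivAt
    (((hasFDerivAt_coord 0 x).pow 2).sub ((hasFDerivAt_coord 1 x).pow 2)) fun v => ?_
  simp
  ring

lemma continuous_saddle : Continuous saddle := by unfold saddle; fun_prop

lemma continuous_coordProd : Continuous coordProd := by unfold coordProd; fun_prop

lemma mem_network_iff (x : Plane) : x ∈ network ↔ coordProd x = 0 := by
  unfold coordProd
  constructor
  · rintro (h | h)
    · rw [mem_singleton_iff] at h; simp [h]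
    · obtain ⟨i, r, -, rfl⟩ := mem_iUnion.1 h
      fin_cases i <;> simp [cardinal]
  · intro h
    have key : ∀ (i : Fin 4) (r : ℝ), 0 < r → x = r • cardinal i → x ∈ network :=
      fun i r hr hx => Or.inr (mem_iUnion.2 ⟨i, r, hr, hx.symm⟩)
    rcases mul_eq_zero.1 h with h0 | h1
    · rcases lt_trichotomy (x 1) 0 with hx | hx | hx
      · refine key 3 (-x 1) (by linarith) ?_
        ext i; fin_cases i <;> simp [cardinal, h0]
      · left; ext i; fin_cases i <;> simp [h0, hx]
      · refine key 1 (x 1) hx ?_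
        ext i; fin_cases i <;> simp [cardinal, h0]
    · rcases lt_trichotomy (x 0) 0 with hx | hx | hx
      · refine key 2 (-x 0) (by linarith) ?_
        ext i; fin_cases i <;> simp [cardinal, h1]
      · left; ext i; fin_cases i <;> simp [h1, hx]
      · refine key 0 (x 0) hx ?_
        ext i; fin_cases i <;> simp [cardinal, h1]

/-- In complex notation (x₁ + ix₂)² = q + 2ip, whence ‖x‖⁴ = q² + 4p². -/
lemma norm_sq_le_saddle (x : Plane) : ‖x‖ ^ 2 ≤ |saddle x| + 2 * |coordProd x| := by
  rw [norm_sq_eq]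
  refine abs_le_of_sq_le_sq' ?_ (by positivity) |>.2
  have h1 := sq_abs (saddle x)
  have h2 := sq_abs (coordProd x)
  have h3 : 0 ≤ |saddle x| * |coordProd x| := by positivity
  have : (x 0 ^ 2 + x 1 ^ 2) ^ 2 = saddle x ^ 2 + 4 * coordProd x ^ 2 := by
    simp only [saddle, coordProd]; ring
  nlinarith

lemma two_mul_abs_coordProd_le (x : Plane) : 2 * |coordProd x| ≤ ‖x‖ ^ 2 := by
  rw [norm_sq_eq, coordProd, abs_mul]
  nlinarith [sq_nonneg (|x 0| - |x 1|), sq_abs (x 0), sq_abs (x 1)]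

lemma norm_gradient_d_sq (x : Plane) : ‖gradient d x‖ ^ 2 = 4 * d x * ‖x‖ ^ 2 := by
  rw [norm_sq_eq, norm_sq_eq, gradient_d_zero, gradient_d_one, d]; ring

/-- Comparison of the squares of two reals of the same sign. -/
lemma sub_sq_le_abs_sq_sub {a b : ℝ} (h : 0 ≤ a * b) : (a - b) ^ 2 ≤ |a ^ 2 - b ^ 2| := by
  have h1 : a ^ 2 - b ^ 2 = (a - b) * (a + b) := by ring
  rw [h1, abs_mul, ← sq_abs (a - b), sq]
  refine mul_le_mul_of_nonneg_left ?_ (abs_nonneg _)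
  refine abs_le_of_sq_le_sq' ?_ (abs_nonneg _) |>.2
  rw [sq_abs, sq_abs]; nlinarith

/-- The bound `E < a ^ 2 - b ^ 2` makes the first coordinate dominate at both points, so b² and b'²
are at most the products |ab| and |a'b'|. What remains is a − a', controlled by |a² − a'²| because
the signs agree. -/
lemma dist_sq_le_aux {a b a' b' E : ℝ} (hb : b ^ 2 ≤ a ^ 2)
    (hq : |(a ^ 2 - b ^ 2) - (a' ^ 2 - b' ^ 2)| ≤ E) (hE : E < a ^ 2 - b ^ 2)
    (hs : 0 ≤ a * a') :
    (a - a') ^ 2 + (b - b') ^ 2 ≤ E + 3 * (|a * b| + |a' * b'|) := by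
  have hq' := abs_le.1 hq
  have hb' : b' ^ 2 ≤ a' ^ 2 := by linarith
  have small : ∀ a b : ℝ, b ^ 2 ≤ a ^ 2 → b ^ 2 ≤ |a * b| := by
    intro a b h
    rw [abs_mul, ← sq_abs b, sq]
    exact mul_le_mul_of_nonneg_right (sq_le_sq.1 h) (abs_nonneg _)
  have h1 := small a b hb
  have h2 := small a' b' hb'
  have h3 := sub_sq_le_abs_sq_sub hs
  have h4 : |a ^ 2 - a' ^ 2| ≤ E + (b ^ 2 + b' ^ 2) := by
    rw [abs_le]; constructor <;> nlinarith [sq_nonneg b, sq_nonneg b']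
  nlinarith [sq_nonneg (b + b')]

/-- Two points whose values of `saddle` are close and which lie on the same side are close to each
other, up to their distance to the network. -/
lemma norm_sub_sq_le {y z : Plane} {E : ℝ} (hq : |saddle y - saddle z| ≤ E)
    (h0 : E < saddle y → 0 ≤ y 0 * z 0) (h1 : saddle y < -E → 0 ≤ y 1 * z 1) :
    ‖y - z‖ ^ 2 ≤ 6 * E + 4 * (|coordProd y| + |coordProd z|) := by
  have hE : 0 ≤ E := (abs_nonneg _).trans hq
  have hp := abs_nonneg (coordProd y)
  have hp' := abs_nonneg (coordProd z)
  rcases lt_or_ge E (saddle y) with hy | hy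
  · have := dist_sq_le_aux (E := E) (by unfold saddle at hy; linarith) hq hy (h0 hy)
    rw [norm_sq_eq]
    simp only [PiLp.sub_apply]
    unfold coordProd at *
    linarith
  rcases lt_or_ge (saddle y) (-E) with hy' | hy'
  · have := dist_sq_le_aux (a := y 1) (b := y 0) (a' := z 1) (b' := z 0) (E := E)
      (by unfold saddle at hy'; linarith)
      (by rw [← abs_neg]; convert hq using 2; unfold saddle; ring)
      (by unfold saddle at hy'; linarith) (h1 hy')
    rw [norm_sq_eq]
    simp only [PiLp.sub_apply]
    unfold coordProd at *
    rw [mul_comm (y 1), mul_comm (z 1)] at this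
    linarith
  -- Remaining case: both values of `saddle` are O(E), so both points are close to the origin and no
  -- sign information is needed.
  · have hy2 : |saddle y| ≤ E := abs_le.2 ⟨hy', hy⟩
    have hz2 : |saddle z| ≤ 2 * E := by
      have := abs_sub_abs_le_abs_sub (saddle z) (saddle y)
      rw [abs_sub_comm] at this; linarith
    have hy3 := norm_sq_le_saddle y
    have hz3 := norm_sq_le_saddle z
    have : ‖y - z‖ ^ 2 ≤ 2 * ‖y‖ ^ 2 + 2 * ‖z‖ ^ 2 := by
      have := norm_sub_le y z
      have h2 : ‖y - z‖ ^ 2 ≤ (‖y‖ + ‖z‖) ^ 2 := by gcongr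
      nlinarith [sq_nonneg (‖y‖ - ‖z‖)]
    linarith

/-- The explicit form of the limit of the gradient flow of `d`. -/
def junctionProj (x : Plane) : Plane :=
  if 0 ≤ saddle x then !₂[SignType.sign (x 0) * √(saddle x), 0]
  else !₂[0, SignType.sign (x 1) * √(-saddle x)]

lemma coordProd_junctionProj (x : Plane) : coordProd (junctionProj x) = 0 := by
  unfold junctionProj coordProd
  split_ifs <;> simp

lemma saddle_toLp (a b : ℝ) : saddle !₂[a, b] = a ^ 2 - b ^ 2 := by simp [saddle]

lemma sign_mul_sq {a b : ℝ} (h : a ≠ 0) : ((SignType.sign a : ℝ) * b) ^ 2 = b ^ 2 := by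
  rcases lt_or_gt_of_ne h with h | h <;> simp [h]

lemma saddle_junctionProj (x : Plane) : saddle (junctionProj x) = saddle x := by
  unfold junctionProj
  split_ifs with h
  · rw [saddle_toLp]
    rcases h.eq_or_lt with h0 | h0
    · simp [← h0]
    · have hx : x 0 ≠ 0 := by
        intro hx; unfold saddle at h0; rw [hx] at h0; nlinarith [sq_nonneg (x 1)]
      rw [sign_mul_sq hx, Real.sq_sqrt h]; simp
  · rw [saddle_toLp]
    push Not at h
    have hx : x 1 ≠ 0 := by
      intro hx; unfold saddle at h; rw [hx] at h; nlinarith [sq_nonneg (x 0)]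
    rw [sign_mul_sq hx, Real.sq_sqrt (by linarith)]; simp

lemma sign_mul_sqrt_mul_nonneg {a b c : ℝ} (h : 0 ≤ a * b) :
    0 ≤ (SignType.sign a : ℝ) * √c * b := by
  have hc := Real.sqrt_nonneg c
  rcases lt_trichotomy a 0 with ha | ha | ha
  · have : b ≤ 0 := by nlinarith
    simp only [ha, sign_neg, SignType.coe_neg, SignType.coe_one]; nlinarith
  · simp [ha]
  · have : 0 ≤ b := by nlinarith
    simp only [ha, sign_pos, SignType.coe_one]; positivity

lemma junctionProj_zero_mul_nonneg {x z : Plane} (h : 0 ≤ x 0 * z 0) :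
    0 ≤ junctionProj x 0 * z 0 := by
  unfold junctionProj
  split_ifs
  · simpa using sign_mul_sqrt_mul_nonneg h
  · simp

lemma junctionProj_one_mul_nonneg {x z : Plane} (h : 0 ≤ x 1 * z 1) :
    0 ≤ junctionProj x 1 * z 1 := by
  unfold junctionProj
  split_ifs
  · simp
  · simpa using sign_mul_sqrt_mul_nonneg h

/-- Version of `norm_sub_sq_le` comparing with the projection on the network. -/
lemma norm_junctionProj_sub_sq_le {x z : Plane} {E : ℝ} (hq : |saddle x - saddle z| ≤ E)
    (h0 : E < saddle x → 0 ≤ x 0 * z 0) (h1 : saddle x < -E → 0 ≤ x 1 * z 1) :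
    ‖junctionProj x - z‖ ^ 2 ≤ 6 * E + 4 * |coordProd z| := by
  have := norm_sub_sq_le (y := junctionProj x) (z := z) (E := E)
    (by rwa [saddle_junctionProj])
    (fun h => junctionProj_zero_mul_nonneg (h0 (by rwa [saddle_junctionProj] at h)))
    (fun h => junctionProj_one_mul_nonneg (h1 (by rwa [saddle_junctionProj] at h)))
  simpa [coordProd_junctionProj] using this

lemma junctionProj_eq_self {x : Plane} (h : coordProd x = 0) : junctionProj x = x := by
  have := norm_junctionProj_sub_sq_le (x := x) (z := x) (E := 0) (by simp)
    (fun _ => mul_self_nonneg _) (fun _ => mul_self_nonneg _)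
  rw [h] at this
  have h2 : ‖junctionProj x - x‖ ^ 2 = 0 := le_antisymm (by simpa using this) (by positivity)
  exact sub_eq_zero.1 (norm_eq_zero.1 (pow_eq_zero_iff two_ne_zero |>.1 h2))

/-- Compare `x` with `junctionProj z`, which has the same `saddle` as `z` and zero `coordProd`: the
squared distance is at most 6|q(x) − q(z)|. The sign conditions hold near `x`, by continuity where a
coordinate of `x` is nonzero and trivially where it vanishes. -/
lemma continuous_junctionProj : Continuous junctionProj := by
  rw [continuous_iff_continuousAt]
  intro x
  have hmul : ∀ i : Fin 2, x i ≠ 0 → ∀ᶠ z : Plane in 𝓝 x, 0 ≤ x i * z i := by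
    intro i hi
    have hc : Continuous fun z : Plane => x i * z i := by fun_prop
    exact (hc.tendsto x).eventually (lt_mem_nhds (mul_self_pos.2 hi)) |>.mono fun _ h => h.le
  have h0 : ∀ᶠ z : Plane in 𝓝 x, 0 < saddle x → 0 ≤ x 0 * z 0 := by
    by_cases h : x 0 = 0
    · refine Eventually.of_forall fun z hz => ?_
      simp [h]
    · exact (hmul 0 h).mono fun _ h _ => h
  have h1 : ∀ᶠ z : Plane in 𝓝 x, saddle x < 0 → 0 ≤ x 1 * z 1 := by
    by_cases h : x 1 = 0
    · refine Eventually.of_forall fun z hz => ?_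
      simp [h]
    · exact (hmul 1 h).mono fun _ h _ => h
  have hlim : Tendsto (fun z : Plane => 6 * |saddle x - saddle z|) (𝓝 x) (𝓝 0) := by
    have hc : Continuous fun z : Plane => 6 * |saddle x - saddle z| := by
      have := continuous_saddle
      fun_prop
    simpa using hc.tendsto x
  rw [ContinuousAt, tendsto_iff_norm_sub_tendsto_zero]
  have hsq : Tendsto (fun z : Plane => ‖junctionProj z - junctionProj x‖ ^ 2) (𝓝 x) (𝓝 0) := by
    refine squeeze_zero' (Eventually.of_forall fun z => by positivity) ?_ hlim
    filter_upwards [h0, h1] with z hz0 hz1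
    have := norm_junctionProj_sub_sq_le (x := x) (z := junctionProj z)
      (E := |saddle x - saddle z|) (by rw [saddle_junctionProj])
      (fun h => by
        rw [mul_comm]
        exact junctionProj_zero_mul_nonneg
          (by rw [mul_comm]; exact hz0 (lt_of_le_of_lt (abs_nonneg _) h)))
      (fun h => by
        rw [mul_comm]
        exact junctionProj_one_mul_nonneg
          (by rw [mul_comm]; exact hz1 (by have := abs_nonneg (saddle x - saddle z); linarith)))
    rw [norm_sub_rev]
    simpa [coordProd_junctionProj] using this
  have := hsq.sqrt
  simpa [Real.sqrt_sq (norm_nonneg _)] using this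

/-! ### A priori estimates for the perturbed trajectories -/

lemma perturbed_eikonal (ε : ℝ) (x : Plane) (a : UnitBall) :
    perturbed eikonal ε x a = (a : Plane) - ε⁻¹ • gradient d x := rfl

lemma norm_coe_unitBall_le (a : UnitBall) : ‖(a : Plane)‖ ≤ 1 := by
  exact mem_closedBall_zero_iff.1 a.2

namespace IsTrajectory

variable {ε : ℝ} {x : Plane} {α : ℝ → UnitBall} {X : ℝ → Plane}

lemma initial (h : IsTrajectory (perturbed eikonal ε) x α X) : X 0 = x := by
  simpa using h.2 0 le_rfl

lemma continuousOn_gradient (h : IsTrajectory (perturbed eikonal ε) x α X) :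
    ContinuousOn (fun s => gradient d (X s)) (Ici 0) :=
  continuous_gradient_d.comp_continuousOn h.1

lemma intervalIntegrable_control (hα : Measurable α) (a b : ℝ) :
    IntervalIntegrable (fun s => (α s : Plane)) volume a b := by
  refine (intervalIntegrable_const (c := (1 : ℝ))).mono_fun ?_ ?_
  · exact (measurable_subtype_coe.comp hα).aestronglyMeasurable
  · exact Eventually.of_forall fun s => by simpa using norm_coe_unitBall_le (α s)

lemma intervalIntegrable (h : IsTrajectory (perturbed eikonal ε) x α X) (hα : Measurable α)
    {a b : ℝ} (ha : 0 ≤ a) (hb : 0 ≤ b) :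
    IntervalIntegrable (fun s => perturbed eikonal ε (X s) (α s)) volume a b := by
  simp only [perturbed_eikonal]
  refine (intervalIntegrable_control hα a b).sub (ContinuousOn.intervalIntegrable ?_)
  have hsub : uIcc a b ⊆ Ici 0 := fun s hs => (le_min ha hb).trans hs.1
  exact (h.continuousOn_gradient.mono hsub).const_smul ε⁻¹

lemma sub_eq (h : IsTrajectory (perturbed eikonal ε) x α X) (hα : Measurable α)
    {a b : ℝ} (ha : 0 ≤ a) (hb : 0 ≤ b) :
    X b - X a = ∫ s in a..b, perturbed eikonal ε (X s) (α s) := by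
  rw [h.2 b hb, h.2 a ha, add_sub_add_left_eq_sub]
  exact intervalIntegral.integral_interval_sub_left (h.intervalIntegrable hα le_rfl hb)
    (h.intervalIntegrable hα le_rfl ha)

/-- An upper bound for the upper right Dini derivative of a differentiable function along a
perturbed trajectory. -/
lemma eventually_slope_lt (h : IsTrajectory (perturbed eikonal ε) x α X) (hα : Measurable α)
    {F : Plane → ℝ} {g : Plane} {u r : ℝ} (hu : 0 ≤ u) (hF : HasGradientAt F g (X u))
    (hr : ‖g‖ - ε⁻¹ * inner ℝ g (gradient d (X u)) < r) :
    ∀ᶠ z in 𝓝[>] u, slope (fun t => F (X t)) u z < r := by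
  obtain ⟨r', hr1, hr2⟩ := exists_between hr
  set K : ℝ := ‖gradient d (X u)‖ + 1
  have hK : 0 < K := by positivity
  set L : ℝ := 1 + |ε⁻¹| * K
  have hL : 0 < L := by positivity
  have hmono : 𝓝[≥] u ≤ 𝓝[Ici 0] u := nhdsWithin_mono u (Ici_subset_Ici.2 hu)
  have hgc : Tendsto (fun s => gradient d (X s)) (𝓝[≥] u) (𝓝 (gradient d (X u))) :=
    (h.continuousOn_gradient u hu).mono_left hmono
  have e1 : ∀ᶠ s in 𝓝[≥] u, ‖g‖ - ε⁻¹ * inner ℝ g (gradient d (X s)) < r' := by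
    have : Tendsto (fun s => ‖g‖ - ε⁻¹ * inner ℝ g (gradient d (X s))) (𝓝[≥] u)
        (𝓝 (‖g‖ - ε⁻¹ * inner ℝ g (gradient d (X u)))) :=
      tendsto_const_nhds.sub ((tendsto_const_nhds.inner hgc).const_mul _)
    exact this.eventually (gt_mem_nhds hr1)
  have e2 : ∀ᶠ s in 𝓝[≥] u, ‖gradient d (X s)‖ < K :=
    hgc.norm.eventually (gt_mem_nhds (lt_add_one _))
  obtain ⟨v, hv, hvs⟩ := mem_nhdsGE_iff_exists_Ico_subset.1 (e1.and e2)
  have hXt : Tendsto X (𝓝[>] u) (𝓝 (X u)) :=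
    (h.1 u hu).mono_left ((nhdsWithin_mono u Ioi_subset_Ici_self).trans hmono)
  -- `L` bounds the speed near `u`, so with this constant the first-order remainder of `F` consumes
  -- only half of the gap r − r'.
  have hc : 0 < (r - r') / (2 * L) := div_pos (by linarith) (by positivity)
  have e3 := hXt.eventually (hF.hasFDerivAt.isLittleO.def hc)
  filter_upwards [e3, Ioo_mem_nhdsGT hv] with z hz hzv
  have hz0 : 0 < z - u := sub_pos.2 hzv.1
  have huz : u ≤ z := hzv.1.le
  have hin : ∀ s ∈ Icc u z, s ∈ Ico u v := fun s hs => ⟨hs.1, hs.2.trans_lt hzv.2⟩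
  have hsub := h.sub_eq hα hu (hu.trans huz)
  have hint := h.intervalIntegrable hα hu (hu.trans huz)
  have b1 : ‖X z - X u‖ ≤ L * (z - u) := by
    rw [hsub]
    have := intervalIntegral.norm_integral_le_of_norm_le_const (a := u) (b := z) (C := L)
      (f := fun s => perturbed eikonal ε (X s) (α s)) ?_
    · rwa [abs_of_pos hz0] at this
    · intro s hs
      rw [uIoc_of_le huz] at hs
      have h2 := (hvs (hin s ⟨hs.1.le, hs.2⟩)).2
      rw [perturbed_eikonal]
      refine (norm_sub_le _ _).trans (add_le_add (norm_coe_unitBall_le _) ?_)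
      rw [norm_smul, Real.norm_eq_abs]
      exact mul_le_mul_of_nonneg_left h2.le (abs_nonneg _)
  have b2 : inner ℝ g (X z - X u) ≤ r' * (z - u) := by
    rw [hsub, ← innerSL_apply_apply ℝ, ← ContinuousLinearMap.intervalIntegral_comp_comm _ hint]
    have := intervalIntegral.integral_mono_on (g := fun _ => r') huz
      (f := fun s => innerSL ℝ g (perturbed eikonal ε (X s) (α s)))
      ⟨(innerSL ℝ g).integrable_comp hint.1, (innerSL ℝ g).integrable_comp hint.2⟩
      intervalIntegrable_const ?_
    · rw [intervalIntegral.integral_const, smul_eq_mul] at this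
      linarith
    · intro s hs
      have h1 := (hvs (hin s hs)).1
      rw [innerSL_apply_apply, perturbed_eikonal, inner_sub_right, inner_smul_right]
      have h3 := real_inner_le_norm g (α s : Plane)
      have h4 := mul_le_mul_of_nonneg_left (norm_coe_unitBall_le (α s)) (norm_nonneg g)
      linarith
  rw [InnerProductSpace.toDual_apply_apply, Real.norm_eq_abs] at hz
  have b3 : (r - r') / (2 * L) * ‖X z - X u‖ ≤ (r - r') / 2 * (z - u) := by
    calc (r - r') / (2 * L) * ‖X z - X u‖ ≤ (r - r') / (2 * L) * (L * (z - u)) := by gcongr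
      _ = (r - r') / 2 * (z - u) := by field_simp
  have b4 := (le_abs_self _).trans (hz.trans b3)
  rw [slope_def_field, div_lt_iff₀ hz0]
  have : 0 < (r - r') * (z - u) := mul_pos (by linarith) hz0
  linarith

/-- Barrier argument: controls are only measurable, so Dini derivatives replace derivatives. The
worst unit control contributes ‖G‖ to the rate of `F`, and the strict inequality is needed only at
contact with `B`. -/
lemma image_le (h : IsTrajectory (perturbed eikonal ε) x α X) (hα : Measurable α)
    {F : Plane → ℝ} {G : Plane → Plane} (hF : ∀ y, HasGradientAt F (G y) y) {a b : ℝ} (ha : 0 ≤ a)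
    {B B' : ℝ → ℝ} (hB : ∀ u, HasDerivAt B (B' u) u) (h0 : F (X a) ≤ B a)
    (bound : ∀ u ∈ Ico a b, F (X u) = B u →
      ‖G (X u)‖ - ε⁻¹ * inner ℝ (G (X u)) (gradient d (X u)) < B' u) :
    ∀ ⦃u⦄, u ∈ Icc a b → F (X u) ≤ B u := by
  have hFc : Continuous F := continuous_iff_continuousAt.2 fun y => (hF y).continuousAt
  refine image_le_of_liminf_slope_right_lt_deriv_boundary (f := fun t => F (X t))
    (f' := fun u => ‖G (X u)‖ - ε⁻¹ * inner ℝ (G (X u)) (gradient d (X u)))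
    (hFc.comp_continuousOn (h.1.mono fun s hs => ha.trans hs.1)) ?_ h0 hB bound
  intro u hu r hr
  exact (h.eventually_slope_lt hα (ha.trans hu.1) (hF _) hr).frequently

/-- The drift points inwards, ⟨x, ∇d⟩ = 4d ≥ 0, so only the control can increase the norm. -/
lemma norm_le (h : IsTrajectory (perturbed eikonal ε) x α X) (hα : Measurable α) (hε : 0 ≤ ε)
    {s t : ℝ} (hs : 0 ≤ s) (hst : s ≤ t) : ‖X t‖ ≤ ‖X s‖ + (t - s) := by
  refine le_of_forall_pos_le_add fun η hη => ?_
  -- The barrier must be strict: it starts higher by δ and has slope larger by δ, a total excess δ(1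
  -- + (t − s)) = η. Squares are compared because the norm is not differentiable at 0.
  set δ : ℝ := η / (1 + (t - s)) with hδ
  have hts : 0 < 1 + (t - s) := by linarith
  have hδ0 : 0 < δ := by positivity
  have hF : ∀ y : Plane, HasGradientAt (fun y : Plane => ‖y‖ ^ 2) ((2 : ℝ) • y) y := by
    intro y
    refine hasGradientAt_of_hasFDerivAt (hasStrictFDerivAt_norm_sq y).hasFDerivAt fun v => ?_
    simp [inner_eq]; ring
  have key := h.image_le hα hF hs (b := t)
    (B := fun u => (‖X s‖ + δ + (1 + δ) * (u - s)) ^ 2)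
    (B' := fun u => 2 * (‖X s‖ + δ + (1 + δ) * (u - s)) * (1 + δ)) ?_ ?_ ?_ ⟨hst, le_rfl⟩
  · have := abs_le_of_sq_le_sq' key (by have := norm_nonneg (X s); nlinarith) |>.2
    have h3 : δ * (1 + (t - s)) = η := by rw [hδ]; field_simp
    linarith
  · intro u
    have := ((((hasDerivAt_id u).sub_const s).const_mul (1 + δ)).const_add (‖X s‖ + δ)).pow 2
    exact this.congr_deriv (by simp)
  · simp only [sub_self, mul_zero, add_zero]
    gcongr; linarith
  · intro u hu hc
    have hpos : 0 < ‖X s‖ + δ + (1 + δ) * (u - s) := by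
      have := norm_nonneg (X s)
      have := sub_nonneg.2 hu.1
      positivity
    have hXu : ‖X u‖ = ‖X s‖ + δ + (1 + δ) * (u - s) := by
      rwa [pow_left_inj₀ (norm_nonneg _) hpos.le two_ne_zero] at hc
    have hin : 0 ≤ ε⁻¹ * inner ℝ ((2 : ℝ) • X u) (gradient d (X u)) := by
      refine mul_nonneg (inv_nonneg.2 hε) ?_
      rw [inner_eq, gradient_d_zero, gradient_d_one]
      simp only [PiLp.smul_apply, smul_eq_mul]
      nlinarith [sq_nonneg (X u 0 * X u 1)]
    rw [norm_smul, ← hXu]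
    rw [← hXu] at hpos
    simp only [Real.norm_ofNat]
    nlinarith

lemma norm_le_initial (h : IsTrajectory (perturbed eikonal ε) x α X) (hα : Measurable α)
    (hε : 0 ≤ ε) {t : ℝ} (ht : 0 ≤ t) : ‖X t‖ ≤ ‖x‖ + t := by
  simpa [h.initial] using h.norm_le hα hε le_rfl ht

/-- ∇q ⟂ ∇d removes the penalization and ‖∇q‖ = 2‖x‖, so the bound does not involve ε. -/
lemma abs_saddle_sub_le (h : IsTrajectory (perturbed eikonal ε) x α X) (hα : Measurable α)
    (hε : 0 ≤ ε) {s t : ℝ} (hs : 0 ≤ s) (hst : s ≤ t) :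
    |saddle (X s) - saddle (X t)| ≤ 2 * (t - s) * (‖X s‖ + (t - s)) := by
  have main : ∀ (σ : ℝ), |σ| = 1 →
      σ * saddle (X t) ≤ σ * saddle (X s) + 2 * (t - s) * (‖X s‖ + (t - s)) := by
    intro σ hσ
    refine le_of_forall_pos_le_add fun η hη => ?_
    set δ : ℝ := η / (1 + (t - s)) with hδ
    have hts : 0 < 1 + (t - s) := by linarith
    have hδ0 : 0 < δ := by positivity
    have hF : ∀ y : Plane, HasGradientAt (fun y => σ * saddle y)
        (σ • !₂[2 * y 0, -(2 * y 1)]) y := by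
      intro y
      refine hasGradientAt_of_hasFDerivAt ((hasGradientAt_saddle y).hasFDerivAt.const_mul σ)
        fun v => ?_
      simp [inner_eq]; ring
    have key := h.image_le hα hF hs (b := t)
      (B := fun u => σ * saddle (X s) + (2 * (‖X s‖ + (t - s)) + δ) * (u - s))
      (B' := fun u => 2 * (‖X s‖ + (t - s)) + δ) ?_ ?_ ?_ ⟨hst, le_rfl⟩
    · have h3 : δ * (1 + (t - s)) = η := by rw [hδ]; field_simp
      nlinarith
    · intro u
      simpa using (((hasDerivAt_id u).sub_const s).const_mul
        (2 * (‖X s‖ + (t - s)) + δ)).const_add (σ * saddle (X s))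
    · simp
    · intro u hu _
      have h1 := h.norm_le hα hε hs hu.1
      have h2 : ‖(!₂[2 * X u 0, -(2 * X u 1)] : Plane)‖ = 2 * ‖X u‖ := by
        rw [← pow_left_inj₀ (norm_nonneg _) (by positivity) two_ne_zero, mul_pow, norm_sq_eq,
          norm_sq_eq]
        simp; ring
      have h3 : inner ℝ (σ • !₂[2 * X u 0, -(2 * X u 1)] : Plane) (gradient d (X u)) = 0 := by
        rw [inner_eq, gradient_d_zero, gradient_d_one]
        simp; ring
      rw [h3, norm_smul, h2, Real.norm_eq_abs, hσ]
      have := hu.2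
      linarith
  rw [abs_le]
  have h1 := main 1 (by simp)
  have h2 := main (-1) (by simp)
  constructor <;> linarith

lemma coord_mul_nonneg (h : IsTrajectory (perturbed eikonal ε) x α X) {s t : ℝ} (hs : 0 ≤ s)
    (hst : s ≤ t) (i : Fin 2) (hne : ∀ u ∈ Icc s t, X u i ≠ 0) : 0 ≤ X s i * X t i := by
  by_contra! hneg
  have hc : ContinuousOn (fun u => X s i * X u i) (Icc s t) := by
    have hcont : Continuous fun y : Plane => X s i * y i := by fun_prop
    exact hcont.comp_continuousOn (h.1.mono fun u hu => hs.trans hu.1)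
  obtain ⟨u, hu, hu0⟩ := intermediate_value_Icc' hst hc ⟨hneg.le, mul_self_nonneg (X s i)⟩
  rcases mul_eq_zero.1 hu0 with h0 | h0
  · exact hne s ⟨le_rfl, hst⟩ h0
  · exact hne u hu h0

lemma abs_saddle_sub_le' (h : IsTrajectory (perturbed eikonal ε) x α X) (hα : Measurable α)
    (hε : 0 ≤ ε) {s t u : ℝ} (hs : 0 ≤ s) (hu : u ∈ Icc s t) :
    |saddle (X s) - saddle (X u)| ≤ 2 * (t - s) * (‖X s‖ + (t - s)) := by
  refine (h.abs_saddle_sub_le hα hε hs hu.1).trans ?_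
  have h1 : u - s ≤ t - s := by linarith [hu.2]
  have h2 : 0 ≤ u - s := by linarith [hu.1]
  have h3 : 0 ≤ t - s := h2.trans h1
  gcongr

/-- At a zero of the first coordinate `saddle` would be nonpositive, but it has no time to fall that
far. -/
lemma zero_mul_nonneg (h : IsTrajectory (perturbed eikonal ε) x α X) (hα : Measurable α)
    (hε : 0 ≤ ε) {s t : ℝ} (hs : 0 ≤ s) (hst : s ≤ t)
    (hq : 2 * (t - s) * (‖X s‖ + (t - s)) < saddle (X s)) : 0 ≤ X s 0 * X t 0 := by
  refine h.coord_mul_nonneg hs hst 0 fun u hu h0 => ?_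
  have h1 := abs_le.1 (h.abs_saddle_sub_le' hα hε hs hu)
  have h2 : saddle (X u) = -(X u 1) ^ 2 := by rw [saddle, h0]; ring
  nlinarith [sq_nonneg (X u 1)]

lemma one_mul_nonneg (h : IsTrajectory (perturbed eikonal ε) x α X) (hα : Measurable α)
    (hε : 0 ≤ ε) {s t : ℝ} (hs : 0 ≤ s) (hst : s ≤ t)
    (hq : saddle (X s) < -(2 * (t - s) * (‖X s‖ + (t - s)))) : 0 ≤ X s 1 * X t 1 := by
  refine h.coord_mul_nonneg hs hst 1 fun u hu h0 => ?_
  have h1 := abs_le.1 (h.abs_saddle_sub_le' hα hε hs hu)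
  have h2 : saddle (X u) = (X u 0) ^ 2 := by rw [saddle, h0]; ring
  nlinarith [sq_nonneg (X u 0)]

/-- This is the equicontinuity estimate: free of ε apart from the `coordProd` terms, which vanish in
the limit. -/
lemma norm_sub_sq_le (h : IsTrajectory (perturbed eikonal ε) x α X) (hα : Measurable α)
    (hε : 0 ≤ ε) {s t : ℝ} (hs : 0 ≤ s) (hst : s ≤ t) :
    ‖X s - X t‖ ^ 2 ≤ 12 * (t - s) * (‖X s‖ + (t - s)) +
      4 * (|coordProd (X s)| + |coordProd (X t)|) := by
  have := NetworkControl.norm_sub_sq_le (h.abs_saddle_sub_le hα hε hs hst)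
    (h.zero_mul_nonneg hα hε hs hst) (h.one_mul_nonneg hα hε hs hst)
  linarith

lemma norm_junctionProj_sub_sq_le (h : IsTrajectory (perturbed eikonal ε) x α X)
    (hα : Measurable α) (hε : 0 ≤ ε) {t : ℝ} (ht : 0 ≤ t) :
    ‖junctionProj x - X t‖ ^ 2 ≤ 12 * t * (‖x‖ + t) + 4 * |coordProd (X t)| := by
  have := NetworkControl.norm_junctionProj_sub_sq_le (h.abs_saddle_sub_le hα hε le_rfl ht)
    (h.zero_mul_nonneg hα hε le_rfl ht) (h.one_mul_nonneg hα hε le_rfl ht)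
  rw [sub_zero, h.initial] at this
  linarith

end IsTrajectory

/-- The penalization forces the trajectories towards the network, uniformly with respect to the
control and to bounded initial conditions. -/
lemma eventually_d_le {R t P : ℝ} (ht : 0 < t) (hP : 0 < P) :
    ∀ᶠ ε in 𝓝[>] (0 : ℝ), ∀ (x : Plane) (α : ℝ → UnitBall) (X : ℝ → Plane), ‖x‖ ≤ R →
      Measurable α → IsTrajectory (perturbed eikonal ε) x α X → d (X t) ≤ P := by
  -- Lower bound for ‖∇d‖² = 4d‖x‖² where d ≥ P, since there ‖x‖² ≥ 2√P.
  set c : ℝ := 8 * P * √P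
  have hc : 0 < c := by positivity
  filter_upwards [tendsto_inv_nhdsGT_zero.eventually_gt_atTop (1 + (2 + R ^ 4 / t) / c),
    self_mem_nhdsWithin] with ε hε hε0 x α X hx hα h
  -- The barrier descends linearly from P + R⁴, which dominates d(x), to P at time `t`. The
  -- threshold on ε⁻¹ makes N − ε⁻¹N² < −R⁴/t at contact, where N = ‖∇d‖.
  have key := h.image_le hα hasGradientAt_d le_rfl (b := t)
    (B := fun u => P + R ^ 4 * (1 - u / t)) (B' := fun u => -(R ^ 4 / t)) ?_ ?_ ?_
    ⟨ht.le, le_rfl⟩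
  · simpa [ht.ne'] using key
  · intro u
    have := ((((hasDerivAt_id u).div_const t).const_sub 1).const_mul (R ^ 4)).const_add P
    exact this.congr_deriv (by ring)
  · rw [h.initial, d_eq]
    have h1 := two_mul_abs_coordProd_le x
    have h2 : |coordProd x| ≤ R ^ 2 := by
      have : ‖x‖ ^ 2 ≤ R ^ 2 := by gcongr
      linarith [abs_nonneg (coordProd x)]
    have h3 : coordProd x ^ 2 ≤ (R ^ 2) ^ 2 := by
      rw [← sq_abs]; gcongr
    simp only [zero_div, sub_zero, mul_one]
    nlinarith
  · intro u hu hc'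
    have hR : 0 ≤ R ^ 4 := by positivity
    have hdP : P ≤ d (X u) := by
      rw [hc']
      have : u / t ≤ 1 := (div_le_one ht).2 hu.2.le
      have := mul_nonneg hR (sub_nonneg.2 this)
      linarith
    have hp : √P ≤ |coordProd (X u)| := by
      rw [d_eq] at hdP
      rw [← Real.sqrt_sq_eq_abs]
      exact Real.sqrt_le_sqrt hdP
    rw [← gradient_d, real_inner_self_eq_norm_sq]
    have hN : c ≤ ‖gradient d (X u)‖ ^ 2 := by
      rw [norm_gradient_d_sq]
      have h1 := two_mul_abs_coordProd_le (X u)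
      have h2 : 2 * √P ≤ ‖X u‖ ^ 2 := by linarith
      calc c = 4 * P * (2 * √P) := by ring
        _ ≤ _ := by gcongr; linarith
    set N := ‖gradient d (X u)‖
    have h5 : (2 + R ^ 4 / t) / c * c = 2 + R ^ 4 / t := by field_simp
    have h6 : (2 + R ^ 4 / t) / c * c ≤ (ε⁻¹ - 1) * N ^ 2 := by
      have : 0 ≤ (2 + R ^ 4 / t) / c := by positivity
      exact mul_le_mul (by linarith) hN hc.le (by linarith)
    nlinarith [sq_nonneg (N - 1)]

/-! ### Costs -/

section Costs

variable {lam : ℝ} {ℓ : Plane → UnitBall → ℝ}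

lemma integrableOn_exp_neg_mul_const (hlam : 0 < lam) (M : ℝ) :
    IntegrableOn (fun t => Real.exp (-lam * t) * M) (Ioi 0) :=
  (exp_neg_integrableOn_Ioi 0 hlam).mul_const M

lemma norm_exp_mul_le {M : ℝ} {x : Plane} {a : UnitBall} (hM : |ℓ x a| ≤ M) (t : ℝ) :
    ‖Real.exp (-lam * t) * ℓ x a‖ ≤ Real.exp (-lam * t) * M := by
  rw [norm_mul, Real.norm_eq_abs, Real.norm_eq_abs, Real.abs_exp]
  gcongr

lemma neg_integral_le_cost (hlam : 0 < lam) {M : ℝ} (hM : ∀ x a, |ℓ x a| ≤ M)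
    (α : ℝ → UnitBall) (X : ℝ → Plane) :
    -∫ t in Ioi (0 : ℝ), Real.exp (-lam * t) * M ≤ cost lam ℓ α X := by
  have := norm_integral_le_of_norm_le (integrableOn_exp_neg_mul_const hlam M)
    (Eventually.of_forall fun t => norm_exp_mul_le (hM (X t) (α t)) t)
  exact (abs_le.1 this).1

lemma cost_congr (hℓ : ∀ (x : Plane) (a b : UnitBall), ℓ x a = ℓ x b) {α β : ℝ → UnitBall}
    {X Y : ℝ → Plane} (h : ∀ t, 0 < t → X t = Y t) : cost lam ℓ α X = cost lam ℓ β Y := by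
  refine setIntegral_congr_fun measurableSet_Ioi fun t ht => ?_
  rw [h t ht, hℓ (Y t) (α t) (β t)]

/-- Dominated convergence. As `ℓ` ignores the control, the controls may be frozen and need not
converge. -/
lemma tendsto_cost (hlam : 0 < lam) (hyp : StandingAssumptions eikonal ℓ)
    (hℓ : ∀ (x : Plane) (a b : UnitBall), ℓ x a = ℓ x b) {α : ℕ → ℝ → UnitBall}
    {β : ℝ → UnitBall} {X : ℕ → ℝ → Plane} {Y : ℝ → Plane}
    (hX : ∀ᶠ n in atTop, ContinuousOn (X n) (Ici 0)) (hlim : ∀ t, 0 < t →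
      Tendsto (fun n => X n t) atTop (𝓝 (Y t))) :
    Tendsto (fun n => cost lam ℓ (α n) (X n)) atTop (𝓝 (cost lam ℓ β Y)) := by
  obtain ⟨-, hc, M, -, m, -, hb⟩ := hyp
  set a₀ : UnitBall := ⟨0, by simp⟩
  have hc₀ : Continuous fun x => ℓ x a₀ := hc.comp (by fun_prop : Continuous fun x => (x, a₀))
  have hα : ∀ n, cost lam ℓ (α n) (X n) = cost lam ℓ (fun _ => a₀) (X n) :=
    fun n => cost_congr hℓ fun _ _ => rfl
  have hβ : cost lam ℓ β Y = cost lam ℓ (fun _ => a₀) Y := cost_congr hℓ fun _ _ => rfl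
  simp only [hα, hβ]
  refine tendsto_integral_filter_of_dominated_convergence _ (hX.mono fun n hn => ?_)
    (Eventually.of_forall fun n => ?_) (integrableOn_exp_neg_mul_const hlam M) ?_
  · refine ContinuousOn.aestronglyMeasurable ?_ measurableSet_Ioi
    have h1 : Continuous fun t : ℝ => Real.exp (-lam * t) := by fun_prop
    exact h1.continuousOn.mul (hc₀.comp_continuousOn (hn.mono Ioi_subset_Ici_self))
  · exact Eventually.of_forall fun t => norm_exp_mul_le (hb _ _ 0).2.2.1 t
  · refine (ae_restrict_iff' measurableSet_Ioi).2 (Eventually.of_forall fun t ht => ?_)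
    exact ((hc₀.tendsto _).comp (hlim t ht)).const_mul _

end Costs

/-! ### Lipschitz curves and trajectories -/

lemma perturbed_zero : perturbed eikonal 0 = eikonal := by
  funext x a
  simp [perturbed]

/-- Coordinatewise, a Lipschitz function is absolutely continuous, hence the integral of its
derivative. -/
lemma lipschitzWith_integral_deriv {Y : ℝ → Plane} (hY : LipschitzWith 1 Y) (a b : ℝ) :
    ∫ s in a..b, deriv Y s = Y b - Y a := by
  have hint : IntervalIntegrable (deriv Y) volume a b := by
    refine (intervalIntegrable_const (c := (1 : ℝ))).mono_fun
      (measurable_deriv Y).aestronglyMeasurable (Eventually.of_forall fun s => ?_)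
    simpa using norm_deriv_le_of_lipschitz hY
  ext i
  have hcoord : LipschitzWith 1 fun t => Y t i := by
    refine LipschitzWith.of_dist_le_mul fun s t => ?_
    refine le_trans ?_ (hY.dist_le_mul s t)
    rw [dist_eq_norm, dist_eq_norm]
    exact PiLp.norm_apply_le (Y s - Y t) i
  have h1 := (EuclideanSpace.proj i : Plane →L[ℝ] ℝ).intervalIntegral_comp_comm hint
  have h2 :=
    (hcoord.lipschitzOnWith (s := uIcc a b)).absolutelyContinuousOnInterval.integral_deriv_eq_sub
  rw [PiLp.sub_apply, ← h2]
  refine h1.symm.trans ?_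
  refine intervalIntegral.integral_congr_ae ?_
  filter_upwards [hY.ae_differentiableAt_real] with s hs _
  exact ((EuclideanSpace.proj i : Plane →L[ℝ] ℝ).hasFDerivAt.comp_hasDerivAt s
    hs.hasDerivAt).deriv.symm

lemma exists_isTrajectory_of_lipschitz {Y : ℝ → Plane}
    (hY : ∀ s t, 0 ≤ s → s ≤ t → ‖Y t - Y s‖ ≤ t - s) :
    ∃ α : ℝ → UnitBall, Measurable α ∧ IsTrajectory eikonal (Y 0) α Y := by
  -- Freezing `Y` before time 0 gives a Lipschitz curve on the whole line, whose derivative serves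
  -- as the control.
  set W : ℝ → Plane := fun t => Y (max t 0) with hW
  have hWL : LipschitzWith 1 W := by
    refine LipschitzWith.of_dist_le_mul fun s t => ?_
    wlog hst : s ≤ t generalizing s t
    · rw [dist_comm, dist_comm s]; exact this t s (le_of_not_ge hst)
    have h1 := hY (max s 0) (max t 0) (le_max_right _ _) (max_le_max_right 0 hst)
    have h2 : max t 0 - max s 0 ≤ t - s := by
      rcases le_total s 0 with hs | hs <;> rcases le_total t 0 with ht | ht <;>
        simp [hs, ht] <;> linarith
    rw [dist_comm, dist_eq_norm, dist_comm, Real.dist_eq, abs_of_nonneg (by linarith)]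
    simpa using h1.trans h2
  have hWY : ∀ t, 0 ≤ t → W t = Y t := fun t ht => by simp [hW, ht]
  have hmem : ∀ t, deriv W t ∈ Metric.closedBall (0 : Plane) 1 := fun t => by
    simpa using norm_deriv_le_of_lipschitz (x₀ := t) hWL
  refine ⟨fun t => ⟨deriv W t, hmem t⟩, (measurable_deriv W).subtype_mk, ?_, fun t ht => ?_⟩
  · exact hWL.continuous.continuousOn.congr fun t ht => (hWY t ht).symm
  · have := lipschitzWith_integral_deriv hWL 0 t
    simp only [eikonal]
    rw [this, hWY t ht, hWY 0 le_rfl, add_sub_cancel]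

/-! ### Limits of perturbed trajectories -/

lemma norm_eq_abs_coord {y : Plane} {i j : Fin 2} (hij : i ≠ j) (hj : y j = 0) :
    ‖y‖ = |y i| := by
  rw [← pow_left_inj₀ (norm_nonneg _) (abs_nonneg _) two_ne_zero, norm_sq_eq, sq_abs]
  fin_cases i <;> fin_cases j <;> simp_all

lemma abs_saddle_sub_eq {y z : Plane} {i j : Fin 2} (hij : i ≠ j) (hy : y j = 0) (hz : z j = 0) :
    |saddle y - saddle z| = |y i ^ 2 - z i ^ 2| := by
  unfold saddle
  fin_cases i <;> fin_cases j <;> simp_all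
  rw [← abs_neg]; congr 1; ring

lemma mul_eq_zero_of_coordProd {y : Plane} (h : coordProd y = 0) {i j : Fin 2} (hij : i ≠ j)
    (hi : y i ≠ 0) : y j = 0 := by
  unfold coordProd at h
  fin_cases i <;> fin_cases j <;> simp_all

/-- A curve in the network along which the variation of `saddle` and of the norm is controlled
infinitesimally has speed at most one. -/
lemma norm_sub_le_of_saddle {X : ℝ → Plane} (h1 : ∀ t, 0 < t → coordProd (X t) = 0)
    (h2 : ∀ s t, 0 < s → s ≤ t → ‖X t‖ ≤ ‖X s‖ + (t - s))
    (h3 : ∀ s t, 0 < s → s ≤ t →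
      |saddle (X s) - saddle (X t)| ≤ 2 * (t - s) * (‖X s‖ + (t - s)))
    (h4 : ∀ s t, 0 < s → s ≤ t → ‖X s - X t‖ ^ 2 ≤ 12 * (t - s) * (‖X s‖ + (t - s)))
    {s t : ℝ} (hs : 0 < s) (hst : s ≤ t) : ‖X t - X s‖ ≤ t - s := by
  set C : ℝ := 12 * (‖X s‖ + 2 * (t - s))
  have hmod : ∀ u ∈ Icc s t, ∀ v ∈ Icc s t, ‖X v - X u‖ ^ 2 ≤ C * |v - u| := by
    intro u hu v hv
    wlog huv : u ≤ v generalizing u v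
    · rw [norm_sub_rev, abs_sub_comm]
      exact this v hv u hu (le_of_not_ge huv)
    have e1 := h4 u v (hs.trans_le hu.1) huv
    have e2 := h2 s u hs hu.1
    rw [norm_sub_rev, abs_of_nonneg (sub_nonneg.2 huv)]
    refine e1.trans ?_
    have : ‖X u‖ + (v - u) ≤ ‖X s‖ + 2 * (t - s) := by
      have := hu.1; have := hu.2; have := hv.2
      linarith
    calc 12 * (v - u) * (‖X u‖ + (v - u)) ≤ 12 * (v - u) * (‖X s‖ + 2 * (t - s)) := by
          have := sub_nonneg.2 huv
          gcongr
      _ = C * (v - u) := by ring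
  have hcont : ContinuousOn X (Icc s t) := by
    intro u hu
    rw [ContinuousWithinAt, tendsto_iff_norm_sub_tendsto_zero]
    have hlim : Tendsto (fun v => √(C * |v - u|)) (𝓝[Icc s t] u) (𝓝 0) := by
      have : Continuous fun v => √(C * |v - u|) := by fun_prop
      simpa using (this.tendsto u).mono_left nhdsWithin_le_nhds
    refine squeeze_zero' (Eventually.of_forall fun v => norm_nonneg _) ?_ hlim
    filter_upwards [self_mem_nhdsWithin] with v hv
    exact Real.le_sqrt_of_sq_le (hmod u hu v hv)
  refine image_le_of_liminf_slope_right_le_deriv_boundary (f := fun u => ‖X u - X s‖)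
    (B := fun u => u - s) (B' := fun _ => 1) (hcont.sub continuousOn_const).norm (by simp)
    (by fun_prop) (fun u _ => ((hasDerivAt_id u).sub_const s).hasDerivWithinAt) ?_ ⟨hst, le_rfl⟩
  intro u hu r hr
  have hu0 : 0 < u := hs.trans_le hu.1
  suffices h : ∀ᶠ z in 𝓝[>] u, ‖X z - X u‖ < r * (z - u) by
    refine (h.and self_mem_nhdsWithin).frequently.mono fun z hz => ?_
    have hzu : 0 < z - u := sub_pos.2 hz.2
    rw [slope_def_field, div_lt_iff₀ hzu]
    refine lt_of_le_of_lt ?_ hz.1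
    have := norm_sub_norm_le (X z - X s) (X u - X s)
    rwa [sub_sub_sub_cancel_right] at this
  -- At the origin `saddle` is degenerate, but there the growth bound on the norm already gives unit
  -- speed.
  by_cases hX : X u = 0
  · filter_upwards [self_mem_nhdsWithin] with z hz
    have hz' : u < z := hz
    have := h2 u z hu0 hz'.le
    rw [hX, norm_zero, zero_add] at this
    rw [hX, sub_zero]
    nlinarith
  -- Away from the origin the curve stays on one half-axis for a short time. Dividing the variation
  -- of Xᵢ² by |X z i| + |X u i|, which tends to 2|X u i|, gives speed at most one.
  obtain ⟨i, hi⟩ : ∃ i, X u i ≠ 0 := by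
    by_contra! h
    exact hX (by ext i; simpa using h i)
  obtain ⟨j, hij⟩ : ∃ j : Fin 2, i ≠ j := ⟨i + 1, by fin_cases i <;> simp⟩
  have huj := mul_eq_zero_of_coordProd (h1 u hu0) hij hi
  have hnu := norm_eq_abs_coord hij huj
  have hm : 0 < |X u i| := abs_pos.2 hi
  have hXz : Tendsto X (𝓝[>] u) (𝓝 (X u)) := by
    have h := hcont u ⟨hu.1, hu.2.le⟩
    refine h.mono_left (nhdsWithin_le_iff.2 ?_)
    filter_upwards [Ioo_mem_nhdsGT hu.2] with z hz
    exact ⟨hu.1.trans hz.1.le, hz.2.le⟩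
  have hXi : Tendsto (fun z => X z i) (𝓝[>] u) (𝓝 (X u i)) :=
    ((EuclideanSpace.proj i : Plane →L[ℝ] ℝ).continuous.tendsto _).comp hXz
  have e1 : ∀ᶠ z in 𝓝[>] u, 0 < X u i * X z i :=
    (hXi.const_mul (X u i)).eventually (lt_mem_nhds (mul_self_pos.2 hi))
  have e2 : ∀ᶠ z in 𝓝[>] u, 0 < r * (|X z i| + |X u i|) - 2 * (|X u i| + (z - u)) := by
    have hz : Tendsto (fun z : ℝ => z) (𝓝[>] u) (𝓝 u) := nhdsWithin_le_nhds
    have : Tendsto (fun z => r * (|X z i| + |X u i|) - 2 * (|X u i| + (z - u))) (𝓝[>] u)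
        (𝓝 (r * (|X u i| + |X u i|) - 2 * (|X u i| + (u - u)))) :=
      ((hXi.abs.add_const _).const_mul r).sub (((hz.sub_const u).const_add _).const_mul 2)
    refine this.eventually (lt_mem_nhds ?_)
    nlinarith
  filter_upwards [e1, e2, self_mem_nhdsWithin] with z hz1 hz2 hz
  have hz' : 0 < z - u := sub_pos.2 hz
  have hzi : X z i ≠ 0 := by
    intro h; simp [h] at hz1
  have hzj := mul_eq_zero_of_coordProd (h1 z (hu0.trans hz)) hij hzi
  have e3 := h3 u z hu0 (le_of_lt hz)
  rw [abs_saddle_sub_eq hij huj hzj, hnu] at e3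
  rw [norm_eq_abs_coord hij (by simp [huj, hzj]), PiLp.sub_apply]
  have e4 : |X u i ^ 2 - X z i ^ 2| = |X z i - X u i| * (|X z i| + |X u i|) := by
    have : |X z i| + |X u i| = |X z i + X u i| := by
      rcases pos_and_pos_or_neg_and_neg_of_mul_pos hz1 with h | h
      · rw [abs_of_pos h.1, abs_of_pos h.2, abs_of_pos (by linarith)]
      · rw [abs_of_neg h.1, abs_of_neg h.2, abs_of_neg (by linarith)]; ring
    rw [this, ← abs_mul, ← abs_neg]; congr 1; ring
  rw [e4] at e3
  have hpos : 0 < |X z i| + |X u i| := by positivity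
  refine lt_of_mul_lt_mul_right (lt_of_le_of_lt e3 ?_) hpos.le
  nlinarith

section Limits

variable {ε : ℕ → ℝ} {x : ℕ → Plane} {x' : Plane} {α : ℕ → ℝ → UnitBall}
  {Y : ℕ → ℝ → Plane} {X : ℝ → Plane}

lemma tendsto_coordProd (hε : Tendsto ε atTop (𝓝[>] 0)) (hx : Tendsto x atTop (𝓝 x'))
    (hα : ∀ n, Measurable (α n))
    (hY : ∀ n, IsTrajectory (perturbed eikonal (ε n)) (x n) (α n) (Y n)) {t : ℝ} (ht : 0 < t) :
    Tendsto (fun n => |coordProd (Y n t)|) atTop (𝓝 0) := by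
  have hR : ∀ᶠ n in atTop, ‖x n‖ ≤ ‖x'‖ + 1 :=
    (hx.norm.eventually (gt_mem_nhds (lt_add_one _))).mono fun _ h => h.le
  rw [Metric.tendsto_atTop']
  intro δ hδ
  have h := hε.eventually (eventually_d_le (R := ‖x'‖ + 1) ht (P := δ ^ 2 / 2) (by positivity))
  obtain ⟨N, hN⟩ := eventually_atTop.1 (h.and hR)
  refine ⟨N, fun n hn => ?_⟩
  have := (hN n hn.le).1 (x n) (α n) (Y n) (hN n hn.le).2 (hα n) (hY n)
  rw [d_eq, ← sq_abs] at this
  rw [Real.dist_eq, sub_zero, abs_abs]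
  refine lt_of_pow_lt_pow_left₀ 2 hδ.le ?_
  have : 0 < δ ^ 2 := by positivity
  linarith

/-- The pointwise limit of perturbed trajectories is, up to its value at time `0`, a curve of unit
speed in the network which starts from the projection of the limit of the initial points. -/
lemma exists_isTrajectory_of_tendsto (hε : Tendsto ε atTop (𝓝[>] 0)) (hε0 : ∀ n, 0 < ε n)
    (hx : Tendsto x atTop (𝓝 x')) (hα : ∀ n, Measurable (α n))
    (hY : ∀ n, IsTrajectory (perturbed eikonal (ε n)) (x n) (α n) (Y n))
    (hlim : ∀ t, 0 < t → Tendsto (fun n => Y n t) atTop (𝓝 (X t))) :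
    ∃ (β : ℝ → UnitBall) (Z : ℝ → Plane), Measurable β ∧
      IsTrajectory eikonal (junctionProj x') β Z ∧ (∀ t, 0 ≤ t → Z t ∈ network) ∧
      ∀ t, 0 < t → Z t = X t := by
  have hp := fun t (ht : 0 < t) => tendsto_coordProd hε hx hα hY ht
  have h1 : ∀ t, 0 < t → coordProd (X t) = 0 := by
    intro t ht
    have := ((continuous_coordProd.tendsto _).comp (hlim t ht)).abs
    exact abs_eq_zero.1 (tendsto_nhds_unique this (hp t ht))
  have h2 : ∀ s t, 0 < s → s ≤ t → ‖X t‖ ≤ ‖X s‖ + (t - s) := fun s t hs hst =>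
    le_of_tendsto_of_tendsto' (hlim t (hs.trans_le hst)).norm
      ((hlim s hs).norm.add_const _) fun n => (hY n).norm_le (hα n) (hε0 n).le hs.le hst
  have h3 : ∀ s t, 0 < s → s ≤ t →
      |saddle (X s) - saddle (X t)| ≤ 2 * (t - s) * (‖X s‖ + (t - s)) := fun s t hs hst =>
    le_of_tendsto_of_tendsto' (((continuous_saddle.tendsto _).comp (hlim s hs)).sub
      ((continuous_saddle.tendsto _).comp (hlim t (hs.trans_le hst)))).abs
      (((hlim s hs).norm.add_const _).const_mul _)
      fun n => (hY n).abs_saddle_sub_le (hα n) (hε0 n).le hs.le hst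
  have h4 : ∀ s t, 0 < s → s ≤ t → ‖X s - X t‖ ^ 2 ≤ 12 * (t - s) * (‖X s‖ + (t - s)) := by
    intro s t hs hst
    have := le_of_tendsto_of_tendsto' (((hlim s hs).sub (hlim t (hs.trans_le hst))).norm.pow 2)
      ((((hlim s hs).norm.add_const _).const_mul _).add
        (((hp s hs).add (hp t (hs.trans_le hst))).const_mul 4))
      fun n => (hY n).norm_sub_sq_le (hα n) (hε0 n).le hs.le hst
    simpa using this
  have h5 : ∀ t, 0 < t → ‖junctionProj x' - X t‖ ^ 2 ≤ 12 * t * (‖x'‖ + t) := by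
    intro t ht
    have := le_of_tendsto_of_tendsto'
      ((((continuous_junctionProj.tendsto _).comp hx).sub (hlim t ht)).norm.pow 2)
      (((hx.norm.add_const _).const_mul _).add ((hp t ht).const_mul 4))
      fun n => (hY n).norm_junctionProj_sub_sq_le (hα n) (hε0 n).le ht.le
    simpa using this
  have h6 : ∀ s t, 0 < s → s ≤ t → ‖X t - X s‖ ≤ t - s := fun s t hs hst =>
    norm_sub_le_of_saddle h1 h2 h3 h4 hs hst
  -- The initial layer makes the limit jump at time 0 from x' to its projection; redefining the
  -- value there restores continuity.
  set Z : ℝ → Plane := fun t => if 0 < t then X t else junctionProj x' with hZ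
  have hZX : ∀ t, 0 < t → Z t = X t := fun t ht => by simp [hZ, ht]
  have hZ0 : Z 0 = junctionProj x' := by simp [hZ]
  have hZL : ∀ s t, 0 ≤ s → s ≤ t → ‖Z t - Z s‖ ≤ t - s := by
    intro s t hs hst
    rcases hs.eq_or_lt with rfl | hs
    · rcases hst.eq_or_lt with rfl | ht
      · simp
      · rw [hZ0, hZX t ht]
        have hl : Tendsto (fun u => (t - u) + √(12 * u * (‖x'‖ + u))) (𝓝[>] 0) (𝓝 (t - 0)) := by
          have : Continuous fun u => (t - u) + √(12 * u * (‖x'‖ + u)) := by fun_prop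
          simpa using (this.tendsto 0).mono_left nhdsWithin_le_nhds
        refine ge_of_tendsto hl ?_
        filter_upwards [Ioo_mem_nhdsGT ht] with u hu
        have e1 := h6 u t hu.1 hu.2.le
        have e2 := Real.le_sqrt_of_sq_le (h5 u hu.1)
        rw [norm_sub_rev] at e2
        have := norm_sub_le_norm_sub_add_norm_sub (X t) (X u) (junctionProj x')
        linarith
    · rw [hZX t (hs.trans_le hst), hZX s hs]
      exact h6 s t hs hst
  obtain ⟨β, hβ, hZt⟩ := exists_isTrajectory_of_lipschitz hZL
  rw [hZ0] at hZt
  refine ⟨β, Z, hβ, hZt, fun t ht => ?_, hZX⟩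
  rw [mem_network_iff]
  rcases ht.eq_or_lt with rfl | ht
  · rw [hZ0, coordProd_junctionProj]
  · rw [hZX t ht, h1 t ht]

end Limits

/-! ### The gradient flow of `d` -/

/-- Since u² − v² = q is conserved, v² solves the Bernoulli equation y' = −4(q + y)y, so v² = b²e/D
with e = exp(−4qt) and D = 1 + 4b²∫e. Keeping the integral avoids dividing by q and covers q = 0.
The last inequality is the decay of ‖∇d‖². -/
lemma exists_scalar_flow_of_le {a b : ℝ} (hab : b ^ 2 ≤ a ^ 2) :
    ∃ u v : ℝ → ℝ, u 0 = a ∧ v 0 = b ∧ ∀ t, 0 ≤ t →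
      HasDerivAt u (-(2 * u t * v t ^ 2)) t ∧ HasDerivAt v (-(2 * u t ^ 2 * v t)) t ∧
      u t ^ 2 - v t ^ 2 = a ^ 2 - b ^ 2 ∧ 0 ≤ a * u t ∧ 0 ≤ b * v t ∧
      4 * u t ^ 2 * v t ^ 2 * (u t ^ 2 + v t ^ 2) * t ^ 3 ≤ 2 := by
  set q : ℝ := a ^ 2 - b ^ 2 with hq
  have hq0 : 0 ≤ q := sub_nonneg.2 hab
  set e : ℝ → ℝ := fun t => Real.exp (-(4 * q * t)) with he
  have hec : Continuous e := by fun_prop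
  have hed : ∀ t, HasDerivAt e (-(4 * q) * e t) t := by
    intro t
    have := ((hasDerivAt_id t).const_mul (4 * q)).neg.exp
    exact this.congr_deriv (by simp [he]; ring)
  have hepos : ∀ t, 0 < e t := fun t => Real.exp_pos _
  set I : ℝ → ℝ := fun t => ∫ s in (0 : ℝ)..t, e s with hI
  have hId : ∀ t, HasDerivAt I (e t) t := fun t =>
    (hec.integral_hasStrictDerivAt 0 t).hasDerivAt
  have hIq : ∀ t, 4 * q * I t = 1 - e t := by
    intro t
    have h1 : ∫ s in (0 : ℝ)..t, (-(4 * q) * e s) = e t - e 0 :=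
      intervalIntegral.integral_eq_sub_of_hasDerivAt (fun s _ => hed s)
        (hec.const_mul _ |>.intervalIntegrable _ _)
    rw [intervalIntegral.integral_const_mul] at h1
    have h2 : e 0 = 1 := by simp [he]
    simp only [hI]
    linarith
  have hIt : ∀ t, 0 ≤ t → t * e t ≤ I t := by
    intro t ht
    have := intervalIntegral.integral_mono_on (μ := volume) (f := fun _ => e t) (g := e) ht
      intervalIntegrable_const (hec.intervalIntegrable _ _) fun s hs => by
        refine Real.exp_le_exp.2 (neg_le_neg ?_)
        have := hs.2
        gcongr
    simpa using this
  set D : ℝ → ℝ := fun t => 1 + 4 * b ^ 2 * I t with hD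
  have hDd : ∀ t, HasDerivAt D (4 * b ^ 2 * e t) t := fun t =>
    ((hId t).const_mul _).const_add 1
  have hDpos : ∀ t, 0 ≤ t → 0 < D t := by
    intro t ht
    have h1 := hIt t ht
    have : 0 ≤ I t := (mul_nonneg ht (hepos t).le).trans h1
    positivity
  have hdr : ∀ t, 0 ≤ t → HasDerivAt (fun s => (√(D s))⁻¹)
      (-(2 * b ^ 2 * e t / D t) * (√(D t))⁻¹) t := by
    intro t ht
    have hp := hDpos t ht
    have hs : √(D t) ≠ 0 := (Real.sqrt_pos.2 hp).ne'
    refine (((hDd t).sqrt hp.ne').inv hs).congr_deriv ?_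
    have hss : √(D t) ^ 2 = D t := Real.sq_sqrt hp.le
    rw [hss]
    field_simp
    ring
  have hr2 : ∀ t, 0 ≤ t → ((√(D t))⁻¹) ^ 2 = (D t)⁻¹ := fun t ht => by
    rw [inv_pow, Real.sq_sqrt (hDpos t ht).le]
  set h : ℝ → ℝ := fun t => Real.exp (-(2 * q * t)) with hh
  have hh2 : ∀ t, h t ^ 2 = e t := by
    intro t
    simp only [hh, he, ← Real.exp_nat_mul]; congr 1; push_cast; ring
  have hhd : ∀ t, HasDerivAt h (-(2 * q) * h t) t := by
    intro t
    have := ((hasDerivAt_id t).const_mul (2 * q)).neg.exp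
    exact this.congr_deriv (by simp [hh]; ring)
  have hcons : ∀ t, 0 ≤ t → (a * (√(D t))⁻¹) ^ 2 - (b * h t * (√(D t))⁻¹) ^ 2 = q := by
    intro t ht
    have hp := hDpos t ht
    rw [mul_pow, mul_pow, mul_pow, hr2 t ht, hh2]
    field_simp
    simp only [hD]
    linear_combination -(b ^ 2) * hIq t - hq
  refine ⟨fun t => a * (√(D t))⁻¹, fun t => b * h t * (√(D t))⁻¹, ?_, ?_, fun t ht => ?_⟩
  · simp [hD, hI]
  · simp [hD, hI, hh]
  have hp := hDpos t ht
  have hv2 : (b * h t * (√(D t))⁻¹) ^ 2 = b ^ 2 * e t * (D t)⁻¹ := by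
    rw [mul_pow, mul_pow, hr2 t ht, hh2]
  have hu2 : (a * (√(D t))⁻¹) ^ 2 = q + (b * h t * (√(D t))⁻¹) ^ 2 := by
    linarith [hcons t ht]
  have hrnn : 0 ≤ (√(D t))⁻¹ := by positivity
  refine ⟨?_, ?_, hcons t ht, ?_, ?_, ?_⟩
  · refine ((hdr t ht).const_mul a).congr_deriv ?_
    rw [hv2]; field_simp
  · refine (((hhd t).const_mul b).mul (hdr t ht)).congr_deriv ?_
    simp only
    rw [hu2, hv2]; field_simp; ring
  · rw [← mul_assoc]; exact mul_nonneg (mul_self_nonneg a) hrnn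
  · have : b * (b * h t * (√(D t))⁻¹) = b ^ 2 * (h t * (√(D t))⁻¹) := by ring
    rw [this]
    have : 0 < h t := Real.exp_pos _
    positivity
  · simp only
    rw [hu2]
    set V : ℝ := (b * h t * (√(D t))⁻¹) ^ 2 with hV
    have hV0 : 0 ≤ V := sq_nonneg _
    have hVD : V * D t = b ^ 2 * e t := by rw [hv2]; field_simp
    -- Algebraic decay of V = v², which suffices when q = 0. For q > 0, exponential decay is traded
    -- for a cubic power of t through e^y ≥ 1 + y³/6. Together they give 16(6/64 + 1/64) ≤ 2.
    have b1 : 4 * V * t ≤ 1 := by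
      have h1 : 4 * b ^ 2 * (t * e t) ≤ D t := by
        have := mul_le_mul_of_nonneg_left (hIt t ht) (by positivity : 0 ≤ 4 * b ^ 2)
        simp only [hD]; linarith
      have h2 : 4 * V * t * D t ≤ 1 * D t := by nlinarith
      exact le_of_mul_le_mul_right h2 hp
    have b2 : V * (1 - e t) ≤ q * e t := by
      have h1 : V * (1 - e t) * D t ≤ q * e t * D t := by
        have e1 : V * (1 - e t) * D t = (1 - e t) * (b ^ 2 * e t) := by
          rw [← hVD]; ring
        have e2 : q * D t = q + b ^ 2 * (1 - e t) := by
          simp only [hD]; linear_combination b ^ 2 * hIq t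
        have e3 : q * e t * D t = e t * (q + b ^ 2 * (1 - e t)) := by rw [← e2]; ring
        have := mul_nonneg hq0 (hepos t).le
        rw [e1, e3]; nlinarith
      exact le_of_mul_le_mul_right h1 hp
    have b3 : 1 + (4 * q * t) ^ 3 / 6 ≤ Real.exp (4 * q * t) := by
      have hy : 0 ≤ 4 * q * t := by positivity
      have := Real.sum_le_exp_of_nonneg hy 4
      simp only [Finset.sum_range_succ, Finset.sum_range_zero, Nat.factorial] at this
      norm_num at this
      nlinarith [sq_nonneg (4 * q * t)]
    have b4 : V * (64 * q ^ 3 * t ^ 3 / 6) ≤ q := by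
      have h1 : e t * Real.exp (4 * q * t) = 1 := by
        simp only [he, ← Real.exp_add]; simp
      have h2 : V * (1 - e t) * Real.exp (4 * q * t) ≤ q * e t * Real.exp (4 * q * t) := by
        gcongr
      have h3 : V * (1 - e t) * Real.exp (4 * q * t) = V * (Real.exp (4 * q * t) - 1) := by
        linear_combination (-V) * h1
      have h4 : q * e t * Real.exp (4 * q * t) = q := by linear_combination q * h1
      rw [h3, h4] at h2
      refine le_trans (mul_le_mul_of_nonneg_left ?_ hV0) h2
      nlinarith
    have b5 : q ^ 2 * V * t ^ 3 ≤ 6 / 64 := by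
      rcases hq0.eq_or_lt with h0 | h0
      · rw [← h0]; norm_num
      · have : (q ^ 2 * V * t ^ 3) * q ≤ 6 / 64 * q := by nlinarith
        exact le_of_mul_le_mul_right this h0
    have b6 : V ^ 3 * t ^ 3 ≤ 1 / 64 := by
      have : (4 * V * t) ^ 3 ≤ 1 ^ 3 := pow_le_pow_left₀ (by positivity) b1 3
      nlinarith
    have b7 : 4 * (q + V) * V * (q + V + V) ≤ 16 * (q ^ 2 * V + V ^ 3) := by
      nlinarith [mul_nonneg hV0 (sq_nonneg (q - V)), mul_nonneg hV0 (sq_nonneg q),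
        mul_nonneg hV0 (sq_nonneg V)]
    calc 4 * (q + V) * V * (q + V + V) * t ^ 3 ≤ 16 * (q ^ 2 * V + V ^ 3) * t ^ 3 := by gcongr
      _ = 16 * (q ^ 2 * V * t ^ 3 + V ^ 3 * t ^ 3) := by ring
      _ ≤ 2 := by linarith

lemma exists_scalar_flow (a b : ℝ) :
    ∃ u v : ℝ → ℝ, u 0 = a ∧ v 0 = b ∧ ∀ t, 0 ≤ t →
      HasDerivAt u (-(2 * u t * v t ^ 2)) t ∧ HasDerivAt v (-(2 * u t ^ 2 * v t)) t ∧
      u t ^ 2 - v t ^ 2 = a ^ 2 - b ^ 2 ∧ 0 ≤ a * u t ∧ 0 ≤ b * v t ∧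
      4 * u t ^ 2 * v t ^ 2 * (u t ^ 2 + v t ^ 2) * t ^ 3 ≤ 2 := by
  rcases le_total (b ^ 2) (a ^ 2) with hab | hab
  · exact exists_scalar_flow_of_le hab
  · obtain ⟨u, v, hu, hv, h⟩ := exists_scalar_flow_of_le hab
    refine ⟨v, u, hv, hu, fun t ht => ?_⟩
    obtain ⟨h1, h2, h3, h4, h5, h6⟩ := h t ht
    refine ⟨h2.congr_deriv (by ring), h1.congr_deriv (by ring), by linarith, h5, h4, ?_⟩
    convert h6 using 1; ring

lemma hasDerivAt_plane {u v : ℝ → ℝ} {u' v' t : ℝ} (hu : HasDerivAt u u' t)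
    (hv : HasDerivAt v v' t) :
    HasDerivAt (fun s => (!₂[u s, v s] : Plane)) !₂[u', v'] t := by
  have h := (hu.smul_const (!₂[1, 0] : Plane)).add (hv.smul_const (!₂[0, 1] : Plane))
  have e : ∀ a b : ℝ, a • (!₂[1, 0] : Plane) + b • (!₂[0, 1] : Plane) = !₂[a, b] := by
    intro a b; ext i; fin_cases i <;> simp
  rw [e] at h
  refine h.congr_of_eventuallyEq (Eventually.of_forall fun s => ?_)
  simp [e]

/-- The gradient flow of `d` exists globally; it conserves `saddle`, stays in its quadrant, and the
speed decays like `t^(-3/2)`. -/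
lemma exists_flow (x : Plane) : ∃ Z : ℝ → Plane, Z 0 = x ∧ ∀ t, 0 ≤ t →
    HasDerivAt Z (-gradient d (Z t)) t ∧ saddle (Z t) = saddle x ∧ 0 ≤ x 0 * Z t 0 ∧
    0 ≤ x 1 * Z t 1 ∧ ‖gradient d (Z t)‖ ^ 2 * t ^ 3 ≤ 2 := by
  obtain ⟨u, v, hu, hv, h⟩ := exists_scalar_flow (x 0) (x 1)
  refine ⟨fun t => !₂[u t, v t], ?_, fun t ht => ?_⟩
  · ext i; fin_cases i <;> simp [hu, hv]
  · obtain ⟨h1, h2, h3, h4, h5, h6⟩ := h t ht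
    refine ⟨?_, ?_, by simpa using h4, by simpa using h5, ?_⟩
    · convert hasDerivAt_plane h1 h2 using 1
      rw [gradient_d]; ext i; fin_cases i <;> simp
    · rw [saddle_toLp, h3, saddle]
    · rw [norm_gradient_d_sq, norm_sq_eq, d]
      simpa [mul_assoc] using h6

/-- From ‖∇d‖² = 4p²‖z‖² ≥ 8|p|³, gradient decay t^(-3/2) becomes decay 1/t of p. -/
lemma abs_coordProd_mul_le {z : Plane} {t : ℝ} (ht : 0 ≤ t)
    (h : ‖gradient d z‖ ^ 2 * t ^ 3 ≤ 2) : |coordProd z| * t ≤ 1 := by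
  have h1 : 8 * |coordProd z| ^ 3 ≤ ‖gradient d z‖ ^ 2 := by
    rw [norm_gradient_d_sq, d_eq, ← sq_abs]
    have := mul_le_mul_of_nonneg_left (two_mul_abs_coordProd_le z)
      (by positivity : 0 ≤ 4 * |coordProd z| ^ 2)
    linarith
  have h2 : 8 * |coordProd z| ^ 3 * t ^ 3 ≤ 2 :=
    (mul_le_mul_of_nonneg_right h1 (by positivity)).trans h
  by_contra! h3
  have h4 := pow_le_pow_left₀ zero_le_one h3.le 3
  rw [mul_pow] at h4
  linarith

lemma norm_junctionProj_sub_flow_sq_le {x z : Plane} (h1 : saddle z = saddle x)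
    (h2 : 0 ≤ x 0 * z 0) (h3 : 0 ≤ x 1 * z 1) :
    ‖junctionProj x - z‖ ^ 2 ≤ 4 * |coordProd z| := by
  have := norm_junctionProj_sub_sq_le (x := x) (z := z) (E := 0) (by simp [h1])
    (fun _ => h2) (fun _ => h3)
  linarith

lemma isFlowLimit_junctionProj (x : Plane) : IsFlowLimit x (junctionProj x) := by
  obtain ⟨Z, hZ0, hZ⟩ := exists_flow x
  refine ⟨Z, ⟨hZ0, fun t ht => (hZ t ht).1.hasDerivWithinAt⟩, ?_⟩
  rw [tendsto_iff_norm_sub_tendsto_zero]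
  have hlim : Tendsto (fun t : ℝ => √(4 * t⁻¹)) atTop (𝓝 0) := by
    simpa using (tendsto_inv_atTop_zero.const_mul 4).sqrt
  refine squeeze_zero' (Eventually.of_forall fun t => norm_nonneg _) ?_ hlim
  filter_upwards [eventually_gt_atTop 0] with t ht
  obtain ⟨-, h1, h2, h3, h4⟩ := hZ t ht.le
  refine Real.le_sqrt_of_sq_le ?_
  rw [norm_sub_rev]
  refine (norm_junctionProj_sub_flow_sq_le h1 h2 h3).trans ?_
  gcongr
  rw [← one_div, le_div_iff₀ ht]
  exact abs_coordProd_mul_le ht.le h4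

/-- A convergent gradient flow converges to an equilibrium. -/
lemma gradient_eq_zero_of_tendsto {x y : Plane} {Z : ℝ → Plane} (hZ : IsGradientFlow x Z)
    (hy : Tendsto Z atTop (𝓝 y)) : gradient d y = 0 := by
  set w := gradient d y
  set f : ℝ → ℝ := fun t => inner ℝ w (Z t) with hf
  have hZc : ContinuousOn Z (Ici 0) := fun t ht => (hZ.2 t ht).continuousWithinAt
  have hfc : ContinuousOn f (Ici 0) := continuousOn_const.inner hZc
  have hfd : ∀ t, 0 < t → HasDerivAt f (-inner ℝ w (gradient d (Z t))) t := by
    intro t ht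
    have h1 := (hZ.2 t ht.le).hasDerivAt (Ici_mem_nhds ht)
    have h2 := (innerSL ℝ w).hasFDerivAt.comp_hasDerivAt t h1
    exact h2.congr_deriv (by rw [innerSL_apply_apply, inner_neg_right])
  -- The increments of ⟨w, Z⟩ over [n, n+1] tend to 0, while its derivative tends to −‖w‖².
  have hmvt : ∀ n : ℕ, ∃ c : ℝ, (n : ℝ) < c ∧
      -inner ℝ w (gradient d (Z c)) = f (n + 1) - f n := by
    intro n
    obtain ⟨c, hc, h⟩ := exists_hasDerivAt_eq_slope f (fun t => -inner ℝ w (gradient d (Z t)))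
      (lt_add_one (n : ℝ)) (hfc.mono fun t ht => (Nat.cast_nonneg n).trans ht.1)
      fun t ht => hfd t ((Nat.cast_nonneg n).trans_lt ht.1)
    exact ⟨c, hc.1, by simpa using h⟩
  choose c hc hce using hmvt
  have hct : Tendsto c atTop atTop :=
    tendsto_atTop_mono (fun n => (hc n).le) tendsto_natCast_atTop_atTop
  have hl1 : Tendsto (fun n => -inner ℝ w (gradient d (Z (c n)))) atTop (𝓝 (-inner ℝ w w)) :=
    (tendsto_const_nhds.inner ((continuous_gradient_d.tendsto y).comp (hy.comp hct))).neg
  have hft : Tendsto f atTop (𝓝 (inner ℝ w y)) := tendsto_const_nhds.inner hy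
  have hl2 : Tendsto (fun n : ℕ => f (n + 1) - f n) atTop (𝓝 (inner ℝ w y - inner ℝ w y)) :=
    (hft.comp (tendsto_natCast_atTop_atTop.atTop_add tendsto_const_nhds)).sub
      (hft.comp tendsto_natCast_atTop_atTop)
  simp only [hce] at hl1
  have := tendsto_nhds_unique hl1 hl2
  rw [sub_self, neg_eq_zero] at this
  exact inner_self_eq_zero.1 this

lemma coordProd_eq_zero_of_gradient {y : Plane} (h : gradient d y = 0) : coordProd y = 0 := by
  have h1 := norm_gradient_d_sq y
  rw [h, norm_zero, d_eq] at h1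
  have h2 := two_mul_abs_coordProd_le y
  by_contra hne
  have : 0 < |coordProd y| := abs_pos.2 hne
  have : 0 < coordProd y ^ 2 := by positivity
  have : 0 < ‖y‖ ^ 2 := by linarith
  nlinarith [mul_pos ‹0 < coordProd y ^ 2› this]

lemma IsGradientFlow.saddle_eq {x : Plane} {Z : ℝ → Plane} (hZ : IsGradientFlow x Z) {t : ℝ}
    (ht : 0 ≤ t) : saddle (Z t) = saddle x := by
  have hZc : ContinuousOn Z (Ici 0) := fun t ht => (hZ.2 t ht).continuousWithinAt
  have := constant_of_has_deriv_right_zero (f := fun t => saddle (Z t)) (a := 0) (b := t)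
    (continuous_saddle.comp_continuousOn (hZc.mono fun s hs => hs.1)) (fun s hs => ?_) t
    ⟨ht, le_rfl⟩
  · simpa [hZ.1] using this
  · have h1 := (hZ.2 s hs.1).mono (Ici_subset_Ici.2 hs.1)
    have h2 := (hasGradientAt_saddle (Z s)).hasFDerivAt.comp_hasDerivWithinAt s h1
    refine h2.congr_deriv ?_
    rw [InnerProductSpace.toDual_apply_apply, inner_neg_right, inner_eq, gradient_d_zero,
      gradient_d_one]
    simp; ring

lemma mul_nonneg_of_forall_ne_zero {f : ℝ → ℝ} (hf : ContinuousOn f (Ici 0))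
    (hne : ∀ t, 0 ≤ t → f t ≠ 0) {t : ℝ} (ht : 0 ≤ t) : 0 ≤ f 0 * f t := by
  by_contra! hneg
  obtain ⟨u, hu, hu0⟩ := intermediate_value_Icc' ht
    (continuousOn_const.mul (hf.mono fun s hs => hs.1) : ContinuousOn (fun u => f 0 * f u) _)
    ⟨hneg.le, mul_self_nonneg (f 0)⟩
  rcases mul_eq_zero.1 hu0 with h0 | h0
  · exact hne 0 le_rfl h0
  · exact hne u hu.1 h0

/-- The limit is an equilibrium with the same `saddle` as `x`, and the dominant coordinate can never
vanish, so it keeps its sign; the comparison estimate with E = 0 forces equality. This pins down the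
choice made in `flowProj` without a uniqueness theorem for the flow. -/
lemma IsFlowLimit.eq_junctionProj {x y : Plane} (h : IsFlowLimit x y) : y = junctionProj x := by
  obtain ⟨Z, hZ, hy⟩ := h
  have hZc : ContinuousOn Z (Ici 0) := fun t ht => (hZ.2 t ht).continuousWithinAt
  have hp := coordProd_eq_zero_of_gradient (gradient_eq_zero_of_tendsto hZ hy)
  have hnn := eventually_ge_atTop (0 : ℝ)
  have hs : saddle y = saddle x := by
    refine tendsto_nhds_unique ((continuous_saddle.tendsto y).comp hy)
      (tendsto_const_nhds.congr' ?_)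
    filter_upwards [hnn] with t ht
    exact (hZ.saddle_eq ht).symm
  have hcoord : ∀ i : Fin 2, (∀ t, 0 ≤ t → Z t i ≠ 0) → 0 ≤ x i * y i := by
    intro i hi
    have hc : Continuous fun z : Plane => z i := by fun_prop
    refine ge_of_tendsto (((hc.tendsto y).comp hy).const_mul (x i)) ?_
    filter_upwards [hnn] with t ht
    have := mul_nonneg_of_forall_ne_zero (hc.comp_continuousOn hZc) hi ht
    simpa [hZ.1] using this
  have := norm_junctionProj_sub_sq_le (x := x) (z := y) (E := 0) (by simp [hs])
    (fun h0 => hcoord 0 fun t ht h => by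
      have h1 := hZ.saddle_eq ht
      rw [saddle, h] at h1
      nlinarith [sq_nonneg (Z t 1)])
    (fun h0 => hcoord 1 fun t ht h => by
      have h1 := hZ.saddle_eq ht
      rw [saddle, h] at h1
      nlinarith [sq_nonneg (Z t 0)])
  rw [hp] at this
  have h2 : ‖junctionProj x - y‖ ^ 2 = 0 := le_antisymm (by simpa using this) (by positivity)
  exact (sub_eq_zero.1 (norm_eq_zero.1 (pow_eq_zero_iff two_ne_zero |>.1 h2))).symm

lemma isFlowLimit_flowProj (x : Plane) : IsFlowLimit x (flowProj x) :=
  Classical.epsilon_spec ⟨_, isFlowLimit_junctionProj x⟩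

lemma flowProj_eq (x : Plane) : flowProj x = junctionProj x :=
  (isFlowLimit_flowProj x).eq_junctionProj

/-! ### Steering towards the network -/

/-- A differentiable arc with admissible velocity can be put in front of a trajectory. -/
lemma exists_concat {ε T : ℝ} (hT : 0 < T) {P v : ℝ → Plane}
    (hv : ∀ t ∈ Icc 0 T, HasDerivAt P (v t) t) (hvc : ContinuousOn v (Icc 0 T))
    (hb : ∀ t ∈ Icc 0 T, ‖v t + ε⁻¹ • gradient d (P t)‖ ≤ 1) {α : ℝ → UnitBall} {Y : ℝ → Plane}
    (hα : Measurable α) (hY : IsTrajectory (perturbed eikonal ε) (P T) α Y) :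
    ∃ (β : ℝ → UnitBall) (W : ℝ → Plane), Measurable β ∧
      IsTrajectory (perturbed eikonal ε) (P 0) β W ∧ (∀ t ∈ Icc 0 T, W t = P t) ∧
      ∀ t, T ≤ t → W t = Y (t - T) := by
  have hPc : ContinuousOn P (Icc 0 T) := fun t ht => (hv t ht).continuousAt.continuousWithinAt
  -- The control that produces velocity `v` by compensating the drift.
  set c : ℝ → Plane := fun t => v t + ε⁻¹ • gradient d (P t) with hc
  have hcc : ContinuousOn c (Icc 0 T) :=
    hvc.add ((continuous_gradient_d.comp_continuousOn hPc).const_smul ε⁻¹)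
  have hmem : ∀ t, c (projIcc 0 T hT.le t) ∈ Metric.closedBall (0 : Plane) 1 := fun t => by
    simpa using hb _ (projIcc 0 T hT.le t).2
  set γ : ℝ → UnitBall := fun t => ⟨c (projIcc 0 T hT.le t), hmem t⟩ with hγ
  have hγm : Measurable γ := by
    have : Continuous γ :=
      ((continuousOn_iff_continuous_domRestrict.1 hcc).comp continuous_projIcc).subtype_mk _
    exact this.measurable
  set β : ℝ → UnitBall := fun t => if t ≤ T then γ t else α (t - T) with hβ
  set W : ℝ → Plane := fun t => if t ≤ T then P t else Y (t - T) with hW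
  have hW1 : ∀ t ∈ Icc 0 T, W t = P t := fun t ht => by simp [hW, ht.2]
  have hW2 : ∀ t, T ≤ t → W t = Y (t - T) := by
    intro t ht
    rcases ht.eq_or_lt with rfl | ht
    · simp [hW, hY.initial]
    · simp [hW, not_le.2 ht]
  have hf1 : ∀ t ∈ Icc 0 T, perturbed eikonal ε (W t) (β t) = v t := by
    intro t ht
    have : β t = γ t := by simp [hβ, ht.2]
    rw [hW1 t ht, this, perturbed_eikonal]
    simp [hγ, projIcc_of_mem hT.le ht, hc]
  have hf2 : ∀ t, T < t → perturbed eikonal ε (W t) (β t) =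
      perturbed eikonal ε (Y (t - T)) (α (t - T)) := by
    intro t ht
    have : β t = α (t - T) := by simp [hβ, not_le.2 ht]
    rw [hW2 t ht.le, this]
  have hWc : ContinuousOn W (Ici 0) := by
    have h1 : ContinuousOn W (Icc 0 T) := hPc.congr hW1
    have h2 : ContinuousOn W (Ici T) := by
      refine ContinuousOn.congr ?_ fun t ht => hW2 t ht
      exact hY.1.comp (by fun_prop) fun t ht => mem_Ici.2 (sub_nonneg.2 ht)
    rw [← Icc_union_Ici_eq_Ici hT.le]
    exact h1.union_of_isClosed h2 isClosed_Icc isClosed_Ici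
  have hi1 : ∀ t ∈ Icc 0 T,
      ∫ s in (0 : ℝ)..t, perturbed eikonal ε (W s) (β s) = P t - P 0 := by
    intro t ht
    have hsub : uIcc 0 t ⊆ Icc 0 T := by
      rw [uIcc_of_le ht.1]; exact Icc_subset_Icc_right ht.2
    rw [intervalIntegral.integral_congr fun s hs => hf1 s (hsub hs)]
    exact intervalIntegral.integral_eq_sub_of_hasDerivAt (fun s hs => hv s (hsub hs))
      (hvc.mono hsub).intervalIntegrable
  refine ⟨β, W, ?_, ⟨hWc, fun t ht => ?_⟩, hW1, hW2⟩
  · exact Measurable.ite measurableSet_Iic hγm (hα.comp (measurable_id.sub_const T))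
  rcases le_total t T with htT | htT
  · rw [hi1 t ⟨ht, htT⟩, hW1 t ⟨ht, htT⟩, add_sub_cancel]
  · have hint1 : IntervalIntegrable (fun s => perturbed eikonal ε (W s) (β s)) volume 0 T := by
      have : ContinuousOn (fun s => perturbed eikonal ε (W s) (β s)) (uIcc 0 T) := by
        rw [uIcc_of_le hT.le]; exact hvc.congr hf1
      exact this.intervalIntegrable
    have hYi := hY.intervalIntegrable hα le_rfl (sub_nonneg.2 htT)
    have hint2 : IntervalIntegrable (fun s => perturbed eikonal ε (W s) (β s)) volume T t := by
      have h := hYi.comp_sub_right T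
      rw [zero_add, sub_add_cancel] at h
      refine h.congr fun s hs => ?_
      rw [uIoc_of_le htT] at hs
      exact (hf2 s hs.1).symm
    have hi2 : ∫ s in T..t, perturbed eikonal ε (W s) (β s) = Y (t - T) - Y 0 := by
      rw [hY.sub_eq hα le_rfl (sub_nonneg.2 htT)]
      have h := intervalIntegral.integral_comp_sub_right (a := T) (b := t)
        (fun s => perturbed eikonal ε (Y s) (α s)) T
      rw [sub_self] at h
      rw [← h]
      refine intervalIntegral.integral_congr_ae (Eventually.of_forall fun s hs => ?_)
      rw [uIoc_of_le htT] at hs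
      exact hf2 s hs.1
    rw [← intervalIntegral.integral_add_adjacent_intervals hint1 hint2,
      hi1 T ⟨hT.le, le_rfl⟩, hi2, hW2 t htT, hY.initial]
    abel

/-- Every trajectory starting at `y` can be delayed by `T` so as to start at `x`. -/
def Reachable (ε : ℝ) (x y : Plane) (T : ℝ) : Prop :=
  0 ≤ T ∧ ∀ (α : ℝ → UnitBall) (Y : ℝ → Plane), Measurable α →
    IsTrajectory (perturbed eikonal ε) y α Y →
    ∃ (β : ℝ → UnitBall) (W : ℝ → Plane), Measurable β ∧
      IsTrajectory (perturbed eikonal ε) x β W ∧ ∀ t, T ≤ t → W t = Y (t - T)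

lemma Reachable.trans {ε S T : ℝ} {x y z : Plane} (h1 : Reachable ε x y S)
    (h2 : Reachable ε y z T) : Reachable ε x z (S + T) := by
  refine ⟨add_nonneg h1.1 h2.1, fun α Y hα hY => ?_⟩
  obtain ⟨β, W, hβ, hW, hWt⟩ := h2.2 α Y hα hY
  obtain ⟨γ, U, hγ, hU, hUt⟩ := h1.2 β W hβ hW
  refine ⟨γ, U, hγ, hU, fun t ht => ?_⟩
  have := h2.1
  rw [hUt t (by linarith), hWt _ (by linarith), sub_sub]

/-- Under the zero control the perturbed equation is the gradient flow run at speed 1/ε. -/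
lemma exists_flow_reachable (x : Plane) {ε τ : ℝ} (hε : 0 < ε) (hτ : 0 < τ) :
    ∃ z, Reachable ε x z τ ∧ saddle z = saddle x ∧ 0 ≤ x 0 * z 0 ∧ 0 ≤ x 1 * z 1 ∧
      ‖gradient d z‖ ^ 2 * (τ / ε) ^ 3 ≤ 2 := by
  obtain ⟨Z, hZ0, hZ⟩ := exists_flow x
  refine ⟨Z (τ / ε), ⟨hτ.le, fun α Y hα hY => ?_⟩, (hZ _ (by positivity)).2⟩
  have hd : ∀ t ∈ Icc 0 τ, HasDerivAt (fun s => Z (s / ε)) (ε⁻¹ • -gradient d (Z (t / ε))) t := by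
    intro t ht
    have h1 := (hZ (t / ε) (div_nonneg ht.1 hε.le)).1
    exact (h1.scomp t ((hasDerivAt_id t).div_const ε)).congr_deriv (by simp)
  have hc : ContinuousOn (fun s => Z (s / ε)) (Icc 0 τ) :=
    fun t ht => (hd t ht).continuousAt.continuousWithinAt
  obtain ⟨β, W, hβ, hW, -, hWt⟩ := exists_concat (ε := ε) hτ hd
    ((continuous_gradient_d.comp_continuousOn hc).neg.const_smul ε⁻¹)
    (fun t _ => by simp) hα hY
  simp only [zero_div, hZ0] at hW
  exact ⟨β, W, hβ, hW, hWt⟩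

/-- Moving along a straight segment. -/
lemma exists_concat_segment {ε T : ℝ} (hT : 0 < T) {x y : Plane}
    (hb : ∀ θ ∈ Icc (0 : ℝ) 1, ‖y - x‖ / T + ‖ε⁻¹ • gradient d (x + θ • (y - x))‖ ≤ 1)
    {α : ℝ → UnitBall} {Y : ℝ → Plane} (hα : Measurable α)
    (hY : IsTrajectory (perturbed eikonal ε) y α Y) :
    ∃ (β : ℝ → UnitBall) (W : ℝ → Plane), Measurable β ∧
      IsTrajectory (perturbed eikonal ε) x β W ∧
      (∀ t ∈ Icc 0 T, W t = x + (t / T) • (y - x)) ∧ ∀ t, T ≤ t → W t = Y (t - T) := by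
  have hd : ∀ t ∈ Icc 0 T, HasDerivAt (fun s => x + (s / T) • (y - x)) (T⁻¹ • (y - x)) t := by
    intro t _
    exact ((((hasDerivAt_id t).div_const T).smul_const (y - x)).const_add x).congr_deriv
      (by simp)
  have hb' : ∀ t ∈ Icc 0 T,
      ‖T⁻¹ • (y - x) + ε⁻¹ • gradient d (x + (t / T) • (y - x))‖ ≤ 1 := by
    intro t ht
    have := hb (t / T) ⟨div_nonneg ht.1 hT.le, (div_le_one hT).2 ht.2⟩
    refine (norm_add_le _ _).trans (le_trans (le_of_eq ?_) this)
    rw [norm_smul T⁻¹, norm_inv, Real.norm_of_nonneg hT.le]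
    ring
  obtain ⟨β, W, hβ, hW, hW1, hW2⟩ := exists_concat (ε := ε) (α := α) (Y := Y) hT hd
    continuousOn_const hb' hα (by simpa [hT.ne'] using hY)
  exact ⟨β, W, hβ, by simpa using hW, hW1, hW2⟩

lemma coordProd_segment {x y : Plane} {j : Fin 2} (hx : x j = 0) (hy : y j = 0) (θ : ℝ) :
    coordProd (x + θ • (y - x)) = 0 := by
  unfold coordProd
  fin_cases j <;> simp_all

/-- Moving along an axis. -/
lemma exists_concat_axis {ε T : ℝ} (hT : 0 < T) {x y : Plane} {j : Fin 2} (hx : x j = 0)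
    (hy : y j = 0) (hxy : ‖y - x‖ ≤ T) {α : ℝ → UnitBall} {Y : ℝ → Plane} (hα : Measurable α)
    (hY : IsTrajectory (perturbed eikonal ε) y α Y) :
    ∃ (β : ℝ → UnitBall) (W : ℝ → Plane), Measurable β ∧
      IsTrajectory (perturbed eikonal ε) x β W ∧
      (∀ t ∈ Icc 0 T, coordProd (W t) = 0) ∧ ∀ t, T ≤ t → W t = Y (t - T) := by
  obtain ⟨β, W, hβ, hW, hW1, hW2⟩ := exists_concat_segment (ε := ε) hT (fun θ _ => by
    rw [gradient_d_eq_zero (coordProd_segment hx hy θ), smul_zero, norm_zero, add_zero]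
    exact (div_le_one hT).2 hxy) hα hY
  exact ⟨β, W, hβ, hW, fun t ht => by rw [hW1 t ht, coordProd_segment hx hy], hW2⟩

lemma reachable_axis {ε T : ℝ} (hT : 0 < T) {x y : Plane} {j : Fin 2} (hx : x j = 0)
    (hy : y j = 0) (hxy : ‖y - x‖ ≤ T) : Reachable ε x y T := by
  refine ⟨hT.le, fun α Y hα hY => ?_⟩
  obtain ⟨β, W, hβ, hW, -, hW2⟩ := exists_concat_axis hT hx hy hxy hα hY
  exact ⟨β, W, hβ, hW, hW2⟩

/-- Shrinking one coordinate does not increase the size of the gradient of `d`. -/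
lemma norm_gradient_d_le {x y : Plane} (h : ∀ i, y i ^ 2 ≤ x i ^ 2) :
    ‖gradient d y‖ ≤ ‖gradient d x‖ := by
  refine abs_le_of_sq_le_sq' ?_ (norm_nonneg _) |>.2
  rw [norm_gradient_d_sq, norm_gradient_d_sq, norm_sq_eq, norm_sq_eq, d, d]
  have h0 := h 0
  have h1 := h 1
  gcongr

/-- Reaching the network from a point with small gradient, by cancelling the smallest coordinate. -/
lemma exists_reachable_axis {ε T : ℝ} (hε : 0 < ε) (hT : 0 < T) {z : Plane}
    (hg : ‖gradient d z‖ ≤ ε / 2) (hp : 4 * |coordProd z| ≤ T ^ 2) :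
    ∃ y, coordProd y = 0 ∧ ‖y - z‖ ≤ T / 2 ∧ Reachable ε z y T := by
  obtain ⟨j, i, hij, hji⟩ : ∃ j i : Fin 2, i ≠ j ∧ z j ^ 2 ≤ z i ^ 2 := by
    rcases le_total (z 0 ^ 2) (z 1 ^ 2) with h | h
    · exact ⟨0, 1, by decide, h⟩
    · exact ⟨1, 0, by decide, h⟩
  have hzj : z j ^ 2 ≤ |coordProd z| := by
    have : |coordProd z| = |z i| * |z j| := by
      rw [coordProd, abs_mul]
      fin_cases i <;> fin_cases j <;> simp_all [mul_comm]
    rw [this, ← sq_abs, sq]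
    exact mul_le_mul_of_nonneg_right (sq_le_sq.1 hji) (abs_nonneg _)
  set e : Plane := PiLp.single 2 j (-z j) with he
  have hej : e j = -z j := by simp [he]
  have hei : e i = 0 := by simp [he, hij]
  have hne : ‖e‖ ≤ T / 2 := by
    rw [he, PiLp.norm_single, Real.norm_eq_abs, abs_neg]
    refine abs_le_of_sq_le_sq' ?_ (by positivity) |>.2
    rw [sq_abs]; linarith
  have hk : ∀ k : Fin 2, k = i ∨ k = j := by
    intro k; fin_cases i <;> fin_cases j <;> fin_cases k <;> simp_all
  have hseg : ∀ θ ∈ Icc (0 : ℝ) 1, ‖gradient d (z + θ • e)‖ ≤ ε / 2 := by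
    intro θ hθ
    refine (norm_gradient_d_le fun k => ?_).trans hg
    rcases hk k with rfl | rfl
    · simp [hei]
    · simp only [PiLp.add_apply, PiLp.smul_apply, smul_eq_mul, hej]
      have h1 : (1 - θ) ^ 2 ≤ 1 := by nlinarith [hθ.1, hθ.2]
      nlinarith [sq_nonneg (z k)]
  refine ⟨z + e, ?_, by simpa using hne, hT.le, fun α Y hα hY => ?_⟩
  · have : (z + e) j = 0 := by simp [hej]
    unfold coordProd
    fin_cases j <;> simp_all
  -- Half of the unit control budget cancels the drift, the other half produces the displacement.
  · have hb : ∀ θ ∈ Icc (0 : ℝ) 1, ‖z + e - z‖ / T +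
        ‖ε⁻¹ • gradient d (z + θ • (z + e - z))‖ ≤ 1 := by
      intro θ hθ
      rw [add_sub_cancel_left, norm_smul, norm_inv, Real.norm_of_nonneg hε.le]
      have h1 : ‖e‖ / T ≤ 1 / 2 := by rw [div_le_iff₀ hT]; linarith
      have h2 : ε⁻¹ * ‖gradient d (z + θ • e)‖ ≤ ε⁻¹ * (ε / 2) := by
        have := hseg θ hθ
        gcongr
      have h3 : ε⁻¹ * (ε / 2) = 1 / 2 := by field_simp
      linarith
    obtain ⟨β, W, hβ, hW, -, hW2⟩ := exists_concat_segment hT hb hα hY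
    exact ⟨β, W, hβ, hW, hW2⟩

/-- In short time, every point can be steered to a point of the network close to its projection. -/
lemma exists_reachable_network (x : Plane) {τ : ℝ} (hτ : 0 < τ) :
    ∃ y, coordProd y = 0 ∧ ‖y - junctionProj x‖ ≤ 2 * τ ∧ Reachable (τ ^ 3 / 8) x y (2 * τ) := by
  have hε : 0 < τ ^ 3 / 8 := by positivity
  obtain ⟨z, hr, hs, h0, h1, hg⟩ := exists_flow_reachable x hε hτ
  have hp := abs_coordProd_mul_le (by positivity) hg
  -- With ε = τ³/8 the flow runs up to time 8/τ², and its decay gives ‖∇d(z)‖ ≤ τ³/16 = ε/2,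
  -- precisely what cancelling a coordinate requires.
  have hdiv : τ / (τ ^ 3 / 8) = 8 / τ ^ 2 := by field_simp
  rw [hdiv] at hg hp
  have hp' : 8 * |coordProd z| ≤ τ ^ 2 := by
    have : |coordProd z| * (8 / τ ^ 2) = 8 * |coordProd z| / τ ^ 2 := by ring
    rw [this, div_le_one (by positivity)] at hp
    exact hp
  have hg' : ‖gradient d z‖ ≤ τ ^ 3 / 8 / 2 := by
    refine abs_le_of_sq_le_sq' ?_ (by positivity) |>.2
    have : ‖gradient d z‖ ^ 2 * (8 / τ ^ 2) ^ 3 = 512 * ‖gradient d z‖ ^ 2 / τ ^ 6 := by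
      field_simp; norm_num
    rw [this, div_le_iff₀ (by positivity)] at hg
    calc ‖gradient d z‖ ^ 2 ≤ 2 * τ ^ 6 / 512 := by linarith
      _ = (τ ^ 3 / 8 / 2) ^ 2 := by ring
  obtain ⟨y, hy, hyz, hr'⟩ := exists_reachable_axis hε hτ hg'
    (by linarith [abs_nonneg (coordProd z)])
  refine ⟨y, hy, ?_, by simpa [two_mul] using hr.trans hr'⟩
  have h2 := norm_junctionProj_sub_flow_sq_le hs h0 h1
  have h3 : ‖junctionProj x - z‖ ≤ τ := by
    refine abs_le_of_sq_le_sq' ?_ hτ.le |>.2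
    linarith [abs_nonneg (coordProd z)]
  rw [norm_sub_rev] at h3
  have := norm_sub_le_norm_sub_add_norm_sub y z (junctionProj x)
  linarith

/-- Ensures that nearby network points are joined by a segment inside Γ: a nonzero coordinate of `w`
persists nearby, and the origin lies on both axes. -/
lemma eventually_exists_common_axis {w : Plane} (hw : coordProd w = 0) :
    ∀ᶠ y in 𝓝 w, coordProd y = 0 → ∃ j : Fin 2, y j = 0 ∧ w j = 0 := by
  by_cases h : w = 0
  · refine Eventually.of_forall fun y hy => ?_
    rcases mul_eq_zero.1 hy with h0 | h0
    · exact ⟨0, h0, by simp [h]⟩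
    · exact ⟨1, h0, by simp [h]⟩
  · obtain ⟨i, hi⟩ : ∃ i, w i ≠ 0 := by
      by_contra! h'
      exact h (by ext i; simpa using h' i)
    obtain ⟨j, hij⟩ : ∃ j : Fin 2, i ≠ j := ⟨i + 1, by fin_cases i <;> simp⟩
    have hc : Continuous fun y : Plane => y i := by fun_prop
    filter_upwards [hc.continuousAt.eventually_ne hi] with y hyi hy
    exact ⟨j, mul_eq_zero_of_coordProd hy hij hyi, mul_eq_zero_of_coordProd hw hij hi⟩

/-! ### Compactness of perturbed trajectories -/

/-- Arzelà–Ascoli by hand: a product of compact balls gives convergence at rational times, and the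
equicontinuity estimate carries it to every t > 0, its `coordProd` error tending to 0 at each
positive time. -/
lemma exists_subseq_tendsto {ε : ℕ → ℝ} {x : ℕ → Plane} {x' : Plane} {α : ℕ → ℝ → UnitBall}
    {Y : ℕ → ℝ → Plane} (hε : Tendsto ε atTop (𝓝[>] 0)) (hε0 : ∀ n, 0 < ε n)
    (hx : Tendsto x atTop (𝓝 x')) (hα : ∀ n, Measurable (α n))
    (hY : ∀ n, IsTrajectory (perturbed eikonal (ε n)) (x n) (α n) (Y n)) :
    ∃ (φ : ℕ → ℕ) (X : ℝ → Plane), StrictMono φ ∧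
      ∀ t, 0 < t → Tendsto (fun n => Y (φ n) t) atTop (𝓝 (X t)) := by
  obtain ⟨R, hR⟩ := hx.norm.bddAbove_range
  have hxR : ∀ n, ‖x n‖ ≤ R := fun n => hR ⟨n, rfl⟩
  have hR0 : 0 ≤ R := (norm_nonneg _).trans (hxR 0)
  have hb : ∀ n t, 0 ≤ t → ‖Y n t‖ ≤ R + t := fun n t ht =>
    ((hY n).norm_le_initial (hα n) (hε0 n).le ht).trans (by linarith [hxR n])
  have hcomp : IsCompact (univ.pi fun r : ℚ => Metric.closedBall (0 : Plane) (R + |(r : ℝ)|)) :=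
    isCompact_univ_pi fun r => isCompact_closedBall _ _
  obtain ⟨g, -, φ, hφ, hg⟩ := hcomp.tendsto_subseq
    (x := fun n => fun r : ℚ => Y n |(r : ℝ)|) fun n r _ => by
      simpa using hb n |(r : ℝ)| (abs_nonneg _)
  have hcauchy : ∀ t, 0 < t → CauchySeq fun n => Y (φ n) t := by
    intro t ht
    refine Metric.cauchySeq_iff'.2 fun δ hδ => ?_
    set C : ℝ := 12 * (R + t)
    have hC : 0 < C := by positivity
    set η : ℝ := min t (δ ^ 2 / (18 * C)) with hη
    have hη0 : 0 < η := lt_min ht (by positivity)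
    obtain ⟨r, hr1, hr2⟩ := exists_rat_btwn (sub_lt_self t hη0)
    have hr0 : (0 : ℝ) < r := by
      have : η ≤ t := min_le_left _ _
      linarith
    have hCr : C * (t - r) ≤ δ ^ 2 / 18 := by
      have h1 : t - r ≤ δ ^ 2 / (18 * C) := by
        have : η ≤ δ ^ 2 / (18 * C) := min_le_right _ _
        linarith
      calc C * (t - r) ≤ C * (δ ^ 2 / (18 * C)) := by gcongr
        _ = δ ^ 2 / 18 := by field_simp
    have hp := fun s (hs : 0 < s) => tendsto_coordProd (hε.comp hφ.tendsto_atTop)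
      (hx.comp hφ.tendsto_atTop) (fun n => hα (φ n)) (fun n => hY (φ n)) hs
    have hsum : Tendsto (fun n => 4 * (|coordProd (Y (φ n) r)| + |coordProd (Y (φ n) t)|)) atTop
        (𝓝 0) := by
      simpa using ((hp r hr0).add (hp t ht)).const_mul 4
    have e1 : ∀ᶠ n in atTop, dist (Y (φ n) t) (Y (φ n) r) < δ / 3 := by
      filter_upwards [hsum.eventually (gt_mem_nhds (by positivity : 0 < δ ^ 2 / 18))] with n hn
      have h1 := (hY (φ n)).norm_sub_sq_le (hα (φ n)) (hε0 (φ n)).le hr0.le hr2.le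
      have h2 : ‖Y (φ n) r‖ + (t - r) ≤ R + t := by linarith [hb (φ n) r hr0.le]
      have h3 : 12 * (t - r) * (‖Y (φ n) r‖ + (t - r)) ≤ C * (t - r) := by
        have : 0 ≤ t - r := by linarith
        calc 12 * (t - r) * (‖Y (φ n) r‖ + (t - r)) ≤ 12 * (t - r) * (R + t) := by gcongr
          _ = C * (t - r) := by ring
      rw [dist_eq_norm, norm_sub_rev]
      refine lt_of_pow_lt_pow_left₀ 2 (by positivity) ?_
      calc ‖Y (φ n) r - Y (φ n) t‖ ^ 2 < δ ^ 2 / 18 + δ ^ 2 / 18 := by linarith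
        _ = (δ / 3) ^ 2 := by ring
    have hgr : Tendsto (fun n => Y (φ n) r) atTop (𝓝 (g r)) := by
      have := (tendsto_pi_nhds.1 hg) r
      simpa [abs_of_pos hr0] using this
    have e2 := hgr.eventually (Metric.ball_mem_nhds _ (by positivity : 0 < δ / 6))
    obtain ⟨N, hN⟩ := eventually_atTop.1 (e1.and e2)
    refine ⟨N, fun n hn => ?_⟩
    have a1 := hN n hn
    have a2 := hN N le_rfl
    have a3 := a1.2
    have a4 := a2.2
    have a5 := a2.1
    rw [dist_comm] at a4 a5
    have b1 := dist_triangle4 (Y (φ n) t) (Y (φ n) r) (Y (φ N) r) (Y (φ N) t)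
    have b2 := dist_triangle (Y (φ n) r) (g r) (Y (φ N) r)
    linarith [a1.1]
  have hlim : ∀ t, ∃ y, 0 < t → Tendsto (fun n => Y (φ n) t) atTop (𝓝 y) := by
    intro t
    by_cases ht : 0 < t
    · obtain ⟨y, hy⟩ := cauchySeq_tendsto_of_complete (hcauchy t ht)
      exact ⟨y, fun _ => hy⟩
    · exact ⟨0, fun h => absurd h ht⟩
  choose X hX using hlim
  exact ⟨φ, X, hφ, hX⟩

/-! ### Value functions -/

lemma IsTrajectory.perturbed_of_network {x : Plane} {α : ℝ → UnitBall} {X : ℝ → Plane}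
    (h : IsTrajectory eikonal x α X) (hX : ∀ t, 0 ≤ t → X t ∈ network) (ε : ℝ) :
    IsTrajectory (perturbed eikonal ε) x α X := by
  refine ⟨h.1, fun t ht => ?_⟩
  rw [h.2 t ht]
  congr 1
  refine intervalIntegral.integral_congr fun s hs => ?_
  rw [uIcc_of_le ht] at hs
  have := (mem_network_iff _).1 (hX s hs.1)
  simp [perturbed, gradient_d_eq_zero this]

lemma isTrajectory_const (x : Plane) :
    IsTrajectory eikonal x (fun _ => (⟨0, by simp⟩ : UnitBall)) fun _ => x :=
  ⟨continuousOn_const, fun t _ => by simp [eikonal]⟩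

/-- The control parameter of `exists_reachable_network` as a function of the penalization. -/
def steeringTime (ε : ℝ) : ℝ := 2 * ε ^ (1 / 3 : ℝ)

lemma steeringTime_pos {ε : ℝ} (hε : 0 < ε) : 0 < steeringTime ε := by
  unfold steeringTime; positivity

lemma steeringTime_cube {ε : ℝ} (hε : 0 < ε) : steeringTime ε ^ 3 / 8 = ε := by
  unfold steeringTime
  rw [mul_pow, ← Real.rpow_natCast (ε ^ _), ← Real.rpow_mul hε.le]
  norm_num

lemma tendsto_steeringTime : Tendsto steeringTime (𝓝[>] 0) (𝓝 0) := by
  have : Continuous steeringTime :=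
    continuous_const.mul (Real.continuous_rpow_const (by norm_num))
  have h := (this.tendsto 0).mono_left (nhdsWithin_le_nhds (s := Ioi 0))
  simpa [steeringTime] using h

section Values

variable {lam : ℝ} {ℓ : Plane → UnitBall → ℝ}

lemma exists_lower_bound_cost (hlam : 0 < lam) (hyp : StandingAssumptions eikonal ℓ) :
    ∃ C : ℝ, ∀ (α : ℝ → UnitBall) (X : ℝ → Plane), C ≤ cost lam ℓ α X := by
  obtain ⟨-, -, M, -, m, -, hb⟩ := hyp
  exact ⟨_, fun α X => neg_integral_le_cost hlam (fun x a => (hb a x 0).2.2.1) α X⟩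

lemma valueNetwork_le_cost (hlam : 0 < lam) (hyp : StandingAssumptions eikonal ℓ) {x : Plane}
    {α : ℝ → UnitBall} {X : ℝ → Plane} (hα : Measurable α) (h : IsTrajectory eikonal x α X)
    (hX : ∀ t, 0 ≤ t → X t ∈ network) : valueNetwork lam eikonal ℓ x ≤ cost lam ℓ α X := by
  obtain ⟨C, hC⟩ := exists_lower_bound_cost hlam hyp
  exact csInf_le ⟨C, by rintro _ ⟨β, Y, -, -, -, rfl⟩; exact hC β Y⟩ ⟨α, X, hα, h, hX, rfl⟩

lemma valuePerturbed_le_cost (hlam : 0 < lam) (hyp : StandingAssumptions eikonal ℓ) {ε : ℝ}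
    {x : Plane} {α : ℝ → UnitBall} {X : ℝ → Plane} (hα : Measurable α)
    (h : IsTrajectory (perturbed eikonal ε) x α X) :
    valuePerturbed lam eikonal ℓ ε x ≤ cost lam ℓ α X := by
  obtain ⟨C, hC⟩ := exists_lower_bound_cost hlam hyp
  exact csInf_le ⟨C, by rintro _ ⟨β, Y, -, -, rfl⟩; exact hC β Y⟩ ⟨α, X, hα, h, rfl⟩

lemma valueLimit_le_cost (hlam : 0 < lam) (hyp : StandingAssumptions eikonal ℓ)
    {x : Plane} {α : ℝ → UnitBall} {X : ℝ → Plane} (hα : Measurable α)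
    (h : X ∈ omegaLimits eikonal x α) : valueLimit lam eikonal ℓ x ≤ cost lam ℓ α X := by
  obtain ⟨C, hC⟩ := exists_lower_bound_cost hlam hyp
  exact csInf_le ⟨C, by rintro _ ⟨β, Y, -, -, rfl⟩; exact hC β Y⟩ ⟨α, X, hα, h, rfl⟩

lemma exists_cost_lt_of_valueNetwork_lt {x : Plane} (hx : x ∈ network) {a : ℝ}
    (h : valueNetwork lam eikonal ℓ x < a) :
    ∃ (α : ℝ → UnitBall) (X : ℝ → Plane), Measurable α ∧ IsTrajectory eikonal x α X ∧
      (∀ t, 0 ≤ t → X t ∈ network) ∧ cost lam ℓ α X < a := by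
  unfold valueNetwork at h
  obtain ⟨_, ⟨α, X, hα, hX, hn, rfl⟩, hlt⟩ := exists_lt_of_csInf_lt
    (by exact ⟨_, _, _, measurable_const, isTrajectory_const x, fun _ _ => hx, rfl⟩) h
  exact ⟨α, X, hα, hX, hn, hlt⟩

lemma exists_cost_lt_of_valuePerturbed_lt {ε : ℝ} (hε : 0 < ε) {x : Plane} {a : ℝ}
    (h : valuePerturbed lam eikonal ℓ ε x < a) :
    ∃ (α : ℝ → UnitBall) (X : ℝ → Plane), Measurable α ∧
      IsTrajectory (perturbed eikonal ε) x α X ∧ cost lam ℓ α X < a := by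
  -- The infimum is informative only over a nonempty set; an admissible trajectory is built by
  -- steering to Γ and resting there.
  obtain ⟨y, hy, -, hr⟩ := exists_reachable_network x (steeringTime_pos hε)
  rw [steeringTime_cube hε] at hr
  obtain ⟨β, W, hβ, hW, -⟩ := hr.2 _ _ measurable_const
    ((isTrajectory_const y).perturbed_of_network (fun _ _ => (mem_network_iff y).2 hy) ε)
  unfold valuePerturbed at h
  obtain ⟨_, ⟨α, X, hα, hX, rfl⟩, hlt⟩ := exists_lt_of_csInf_lt
    (by exact ⟨_, β, W, hβ, hW, rfl⟩) h
  exact ⟨α, X, hα, hX, hlt⟩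

lemma valuePerturbed_le_valueNetwork (hlam : 0 < lam) (hyp : StandingAssumptions eikonal ℓ)
    {x : Plane} (hx : x ∈ network) (ε : ℝ) :
    valuePerturbed lam eikonal ℓ ε x ≤ valueNetwork lam eikonal ℓ x := by
  refine le_of_forall_gt fun a ha => ?_
  obtain ⟨α, X, hα, hX, hn, hlt⟩ := exists_cost_lt_of_valueNetwork_lt hx ha
  exact (valuePerturbed_le_cost hlam hyp hα (hX.perturbed_of_network hn ε)).trans_lt hlt

lemma mem_omegaLimits_of_network {x : Plane} {α : ℝ → UnitBall} {X : ℝ → Plane}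
    (hα : Measurable α) (h : IsTrajectory eikonal x α X) (hX : ∀ t, 0 ≤ t → X t ∈ network) :
    X ∈ omegaLimits eikonal x α := by
  refine ⟨⟨fun s => (α s : Plane), fun a b ha hab => ⟨?_, ?_⟩⟩, fun _ => 0,
    fun n => 1 / ((n : ℝ) + 1), fun _ => X, fun n => by positivity,
    tendsto_one_div_add_atTop_nhds_zero_nat, fun n => h.perturbed_of_network hX _, ?_, ?_⟩
  · exact MemLp.of_bound (measurable_subtype_coe.comp hα).aestronglyMeasurable 1
      (Eventually.of_forall fun s => norm_coe_unitBall_le (α s))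
  · rw [← perturbed_zero] at h
    rw [h.sub_eq hα ha.le (ha.le.trans hab), perturbed_zero]
    rfl
  · exact fun u hu t _ => ⟨univ, univ_mem, Eventually.of_forall fun n y _ => refl_mem_uniformity hu⟩
  · refine fun u hu t ht => ⟨Ioi 0, self_mem_nhdsWithin, Eventually.of_forall fun n y hy => ?_⟩
    have : penalization (1 / ((n : ℝ) + 1)) X y = 0 := by
      rw [penalization, intervalIntegral.integral_congr (g := fun _ => 0),
        intervalIntegral.integral_zero, smul_zero]
      intro s hs
      rw [uIcc_of_le (le_of_lt hy)] at hs
      exact gradient_d_eq_zero ((mem_network_iff _).1 (hX s hs.1))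
    simp only [this]
    exact refl_mem_uniformity hu

/-- On the network, the limit value function is the value function of the control problem
constrained to the network. -/
lemma valueLimit_eq_valueNetwork (hlam : 0 < lam) (hyp : StandingAssumptions eikonal ℓ)
    (hℓ : ∀ (x : Plane) (a b : UnitBall), ℓ x a = ℓ x b) {x : Plane} (hx : x ∈ network) :
    valueLimit lam eikonal ℓ x = valueNetwork lam eikonal ℓ x := by
  refine le_antisymm (le_of_forall_gt fun a ha => ?_) ?_
  · obtain ⟨α, X, hα, hX, hn, hlt⟩ := exists_cost_lt_of_valueNetwork_lt hx ha
    exact (valueLimit_le_cost hlam hyp hα (mem_omegaLimits_of_network hα hX hn)).trans_lt hlt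
  · refine le_csInf ⟨_, _, _, measurable_const, mem_omegaLimits_of_network measurable_const
      (isTrajectory_const x) fun _ _ => hx, rfl⟩ ?_
    rintro _ ⟨α, X, hα, ⟨-, k, ε, Y, hε0, hε, hY, hYX, -⟩, rfl⟩
    obtain ⟨β, Z, hβ, hZ, hn, hZX⟩ := exists_isTrajectory_of_tendsto
      (tendsto_nhdsWithin_iff.2 ⟨hε, Eventually.of_forall hε0⟩) hε0 tendsto_const_nhds
      (fun _ => hα) hY fun t ht => hYX.tendsto_at ht
    rw [junctionProj_eq_self ((mem_network_iff x).1 hx)] at hZ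
    refine (valueNetwork_le_cost hlam hyp hβ hZ hn).trans_eq ?_
    exact cost_congr hℓ hZX

lemma tendsto_delayed {X : ℝ → Plane} (hX : ContinuousOn X (Ici 0)) {W : ℕ → ℝ → Plane}
    {S : ℕ → ℝ} (hS : Tendsto S atTop (𝓝 0))
    (hW : ∀ᶠ n in atTop, ∀ t, S n ≤ t → W n t = X (t - S n)) {t : ℝ} (ht : 0 < t) :
    Tendsto (fun n => W n t) atTop (𝓝 (X t)) := by
  have h1 : Tendsto (fun n => t - S n) atTop (𝓝 t) := by simpa using hS.const_sub t
  have h2 := (hX.continuousAt (Ici_mem_nhds ht)).tendsto.comp h1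
  refine h2.congr' ?_
  filter_upwards [hW, hS.eventually (gt_mem_nhds ht)] with n hn hSn
  exact (hn t hSn.le).symm

/-- The perturbed value functions converge to the network one at the projected point. -/
lemma tendsto_valuePerturbed (hlam : 0 < lam) (hyp : StandingAssumptions eikonal ℓ)
    (hℓ : ∀ (x : Plane) (a b : UnitBall), ℓ x a = ℓ x b) {ε : ℕ → ℝ} {x : ℕ → Plane} {x' : Plane}
    (hε : Tendsto ε atTop (𝓝[>] 0)) (hε0 : ∀ n, 0 < ε n) (hx : Tendsto x atTop (𝓝 x')) :
    Tendsto (fun n => valuePerturbed lam eikonal ℓ (ε n) (x n)) atTop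
      (𝓝 (valueNetwork lam eikonal ℓ (junctionProj x'))) := by
  have hnet := coordProd_junctionProj x'
  refine tendsto_order.2 ⟨fun a ha => ?_, fun a ha => ?_⟩
  -- Lower bound: near-optimal trajectories along a bad subsequence converge to a network trajectory
  -- that is too cheap.
  · by_contra hcon
    obtain ⟨φ, hφ, hle⟩ := extraction_of_frequently_atTop (not_eventually.1 hcon)
    obtain ⟨b, hab, hb⟩ := exists_between ha
    have hex := fun n => exists_cost_lt_of_valuePerturbed_lt (hε0 (φ n))
      ((not_lt.1 (hle n)).trans_lt hab)
    choose α Y hα hY hlt using hex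
    have hεφ := hε.comp hφ.tendsto_atTop
    have hxφ := hx.comp hφ.tendsto_atTop
    obtain ⟨ψ, X, hψ, hX⟩ := exists_subseq_tendsto hεφ (fun n => hε0 (φ n)) hxφ hα hY
    obtain ⟨β, Z, hβ, hZ, hn, hZX⟩ := exists_isTrajectory_of_tendsto
      (hεφ.comp hψ.tendsto_atTop) (fun n => hε0 (φ (ψ n))) (hxφ.comp hψ.tendsto_atTop)
      (fun n => hα (ψ n)) (fun n => hY (ψ n)) hX
    have hc := tendsto_cost (α := fun n => α (ψ n)) (β := β) hlam hyp hℓ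
      (Eventually.of_forall fun n => (hY (ψ n)).1) hX
    have h1 := le_of_tendsto' hc fun n => (hlt (ψ n)).le
    have h2 := valueNetwork_le_cost hlam hyp hβ hZ hn
    rw [cost_congr hℓ (β := β) hZX] at h2
    linarith
  · obtain ⟨α, X, hα, hX, hn, hlt⟩ :=
      exists_cost_lt_of_valueNetwork_lt ((mem_network_iff _).2 hnet) ha
    have hex := fun n => exists_reachable_network (x n) (steeringTime_pos (hε0 n))
    choose y hy hyx hr using hex
    have hτ : Tendsto (fun n => steeringTime (ε n)) atTop (𝓝 0) := tendsto_steeringTime.comp hε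
    have hproj := (continuous_junctionProj.tendsto x').comp hx
    have hyw : Tendsto y atTop (𝓝 (junctionProj x')) := by
      have h0 : Tendsto (fun n => y n - junctionProj (x n)) atTop (𝓝 0) :=
        squeeze_zero_norm hyx (by simpa using hτ.const_mul 2)
      simpa using h0.add hproj
    -- Upper bound: a near-optimal network trajectory is followed with delay `S n`. The extra
    -- `steeringTime` keeps the axis leg of positive duration even if `y n` is already the target.
    set S : ℕ → ℝ := fun n => 2 * steeringTime (ε n) +
      (‖junctionProj x' - y n‖ + steeringTime (ε n)) with hS
    have hS0 : Tendsto S atTop (𝓝 0) := by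
      have : Tendsto (fun n => ‖junctionProj x' - y n‖) atTop (𝓝 0) := by
        simpa using (hyw.const_sub (junctionProj x')).norm
      simpa using (hτ.const_mul 2).add (this.add hτ)
    have hW : ∀ᶠ n in atTop, ∃ p : (ℝ → UnitBall) × (ℝ → Plane), Measurable p.1 ∧
        IsTrajectory (perturbed eikonal (ε n)) (x n) p.1 p.2 ∧
        ∀ t, S n ≤ t → p.2 t = X (t - S n) := by
      filter_upwards [hyw.eventually (eventually_exists_common_axis hnet)] with n hax
      obtain ⟨j, hj1, hj2⟩ := hax (hy n)
      have hτn := steeringTime_pos (hε0 n)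
      have h1 := hr n
      rw [steeringTime_cube (hε0 n)] at h1
      have h2 : Reachable (ε n) (y n) (junctionProj x')
          (‖junctionProj x' - y n‖ + steeringTime (ε n)) :=
        reachable_axis (by positivity) hj1 hj2 (by linarith)
      obtain ⟨β, W, hβ, hW, hWt⟩ :=
        (h1.trans h2).2 α X hα (hX.perturbed_of_network hn (ε n))
      exact ⟨(β, W), hβ, hW, hWt⟩
    obtain ⟨p, hp⟩ := hW.choice
    have hc := tendsto_cost (α := fun n => (p n).1) (β := α) hlam hyp hℓ
      (hp.mono fun n h => h.2.1.1)
      fun t ht => tendsto_delayed hX.1 hS0 (hp.mono fun n h => h.2.2) ht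
    filter_upwards [hp, hc.eventually (gt_mem_nhds hlt)] with n h1 h2
    exact (valuePerturbed_le_cost hlam hyp h1.1 h1.2.1).trans_lt h2

/-- The lower bound comes from V^ε ≤ V_Γ on Γ and the convergence of V^ε; the upper bound from first
moving along the common axis. -/
lemma tendsto_valueNetwork (hlam : 0 < lam) (hyp : StandingAssumptions eikonal ℓ)
    (hℓ : ∀ (x : Plane) (a b : UnitBall), ℓ x a = ℓ x b) {w : ℕ → Plane} {w' : Plane}
    (hw : Tendsto w atTop (𝓝 w')) (hwn : ∀ n, coordProd (w n) = 0) (hw' : coordProd w' = 0) :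
    Tendsto (fun n => valueNetwork lam eikonal ℓ (w n)) atTop
      (𝓝 (valueNetwork lam eikonal ℓ w')) := by
  refine tendsto_order.2 ⟨fun a ha => ?_, fun a ha => ?_⟩
  · have hε0 : ∀ n : ℕ, 0 < 1 / ((n : ℝ) + 1) := fun n => by positivity
    have h := tendsto_valuePerturbed hlam hyp hℓ (tendsto_nhdsWithin_iff.2
      ⟨tendsto_one_div_add_atTop_nhds_zero_nat, Eventually.of_forall hε0⟩) hε0 hw
    rw [junctionProj_eq_self hw'] at h
    filter_upwards [h.eventually (lt_mem_nhds ha)] with n hn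
    exact hn.trans_le (valuePerturbed_le_valueNetwork hlam hyp ((mem_network_iff _).2 (hwn n)) _)
  · obtain ⟨α, X, hα, hX, hn, hlt⟩ :=
      exists_cost_lt_of_valueNetwork_lt ((mem_network_iff _).2 hw') ha
    set S : ℕ → ℝ := fun n => ‖w' - w n‖ + 1 / ((n : ℝ) + 1) with hS
    have hS0 : Tendsto S atTop (𝓝 0) := by
      have : Tendsto (fun n => ‖w' - w n‖) atTop (𝓝 0) := by
        simpa using (hw.const_sub w').norm
      simpa [hS] using this.add tendsto_one_div_add_atTop_nhds_zero_nat
    have hW : ∀ᶠ n in atTop, ∃ p : (ℝ → UnitBall) × (ℝ → Plane), Measurable p.1 ∧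
        IsTrajectory eikonal (w n) p.1 p.2 ∧ (∀ t, 0 ≤ t → p.2 t ∈ network) ∧
        ∀ t, S n ≤ t → p.2 t = X (t - S n) := by
      filter_upwards [hw.eventually (eventually_exists_common_axis hw')] with n hax
      obtain ⟨j, hj1, hj2⟩ := hax (hwn n)
      have hn1 : 0 < 1 / ((n : ℝ) + 1) := by positivity
      -- Since 0⁻¹ = 0, the choice ε = 0 is the unperturbed dynamics.
      obtain ⟨β, W, hβ, hW, hW1, hW2⟩ := exists_concat_axis (ε := 0) (T := S n)
        (by positivity) hj1 hj2 (by simp only [hS]; linarith) hα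
        (hX.perturbed_of_network hn 0)
      rw [perturbed_zero] at hW
      refine ⟨(β, W), hβ, hW, fun t ht => ?_, hW2⟩
      rcases le_total t (S n) with h | h
      · exact (mem_network_iff _).2 (hW1 t ⟨ht, h⟩)
      · simp only [hW2 t h]
        exact hn _ (sub_nonneg.2 h)
    obtain ⟨p, hp⟩ := hW.choice
    have hc := tendsto_cost (α := fun n => (p n).1) (β := α) hlam hyp hℓ
      (hp.mono fun n h => h.2.1.1)
      fun t ht => tendsto_delayed hX.1 hS0 (hp.mono fun n h => h.2.2.2) ht
    filter_upwards [hp, hc.eventually (gt_mem_nhds hlt)] with n h1 h2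
    exact (valueNetwork_le_cost hlam hyp h1.1 h1.2.1 h1.2.2.1).trans_lt h2

lemma flowProj_mem_network (x : Plane) : flowProj x ∈ network := by
  rw [flowProj_eq, mem_network_iff, coordProd_junctionProj]

/-- Locally uniform convergence is tested on joint sequences (εₙ, xₙ): V^ε at xₙ and V_Γ at its
projection have the same limit. -/
lemma tendstoLocallyUniformly_valuePerturbed (hlam : 0 < lam)
    (hyp : StandingAssumptions eikonal ℓ) (hℓ : ∀ (x : Plane) (a b : UnitBall), ℓ x a = ℓ x b) :
    TendstoLocallyUniformly (fun ε : ℝ => valuePerturbed lam eikonal ℓ ε)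
      (valueLimit lam eikonal ℓ ∘ flowProj) (𝓝[>] 0) := by
  rw [tendstoLocallyUniformly_iff_forall_tendsto]
  refine fun x => tendsto_of_seq_tendsto fun u hu => ?_
  have hε : Tendsto (fun n => (u n).1) atTop (𝓝[>] 0) := tendsto_fst.comp hu
  have hx : Tendsto (fun n => (u n).2) atTop (𝓝 x) := tendsto_snd.comp hu
  obtain ⟨N, hN⟩ := eventually_atTop.1 (hε.eventually self_mem_nhdsWithin)
  -- Shifting the index makes every εₙ positive, not just eventually.
  refine (tendsto_add_atTop_iff_nat N).1 ?_
  have hεN := (tendsto_add_atTop_iff_nat N).2 hε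
  have hxN := (tendsto_add_atTop_iff_nat N).2 hx
  have h1 := tendsto_valuePerturbed hlam hyp hℓ hεN (fun n => hN _ (Nat.le_add_left N n)) hxN
  have h2 := tendsto_valueNetwork hlam hyp hℓ ((continuous_junctionProj.tendsto x).comp hxN)
    (fun n => coordProd_junctionProj _) (coordProd_junctionProj x)
  refine ((h2.prodMk_nhds h1).mono_right (nhds_le_uniformity _)).congr fun n => ?_
  simp only [Function.comp_apply]
  rw [valueLimit_eq_valueNetwork hlam hyp hℓ (flowProj_mem_network _), flowProj_eq]

end Values

end NetworkControl

end

open NetworkControl in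
theorem theorem3 (lam : ℝ) (hlam : 0 < lam)
    (ℓ : Plane → UnitBall → ℝ) (hyp : StandingAssumptions eikonal ℓ)
    (hℓ : ∀ (x : Plane) (a b : UnitBall), ℓ x a = ℓ x b) :
    (∀ x ∈ network, valueLimit lam eikonal ℓ x = valueNetwork lam eikonal ℓ x) ∧
    (∀ x : Plane, IsFlowLimit x (flowProj x) ∧ flowProj x ∈ network) ∧
    TendstoLocallyUniformly (fun ε : ℝ => valuePerturbed lam eikonal ℓ ε)
      (valueLimit lam eikonal ℓ ∘ flowProj) (𝓝[>] 0) :=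
  ⟨fun _ hx => valueLimit_eq_valueNetwork hlam hyp hℓ hx,
    fun x => ⟨isFlowLimit_flowProj x, flowProj_mem_network x⟩,
    tendstoLocallyUniformly_valuePerturbed hlam hyp hℓ⟩
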